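/- **Setting.** There are $N$ generators. Generator $i$ has cost $C_i(p)=a_i+b_ip+c_ip^2$ with $c_i>0$ and capacity limits $P_i^{\min},P_i^{\max}$. For $\delta>0$ let $$C_i^\delta(p)=C_i(p)-\delta\big(\ln(p-P_i^{\min})+\ln(P_i^{\max}-p)\big),\qquad \tilde w_i(p)=b_i+2c_ip-\frac{\delta}{p-P_i^{\min}}+\frac{\delta}{P_i^{\max}-p},$$ and write $\tilde w_i$ for $\tilde w_i(P_i)$. For a demand $P_D$ let $\mathcal F$ be the set of $P\in\mathbb R^N$ with $P_i^{\min}<P_i<P_i^{\max}$ for all $i$ and $\sum_iP_i=P_D$; assume $\mathcal F\ne\emptyset$. The modified dispatch problem is to minimize $\sum_iC_i^\delta(P_i)$ over $\mathcal F$. Let $G_1,\dots,G_M$ be connected undirected graphs on the $N$ generators, and let $s$ be a switching signal, i.e. a right-continuous, piecewise constant map $[0,\infty)\to\{1,\dots,M\}$ with finitely many switches in every bounded interval. Let $\beta_{ij}=\beta_{ji}>0$. The adaptive protocol over the switching topology is $$\dot P_i=\sum_{j\in N_i(t)}a_{ij}(t)(\tilde w_j-\tilde w_i),\qquad \dot a_{ij}=\beta_{ij}(\tilde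 w_i-\tilde w_j)^2\ \ (j\in N_i(t)),\qquad \dot a_{ij}=0\ \ (j\notin N_i(t)),$$ where $N_i(t)$ is the set of neighbours of $i$ in $G_{s(t)}$; solutions are continuous and satisfy the equations with right derivatives at every $t\ge0$. Initial data are *admissible* if $P(0)\in\mathcal F$, $a_{ij}(0)=a_{ji}(0)$, and $a_{ij}(0)>0$ for every link $ij$ of every $G_k$; *admissible weights* are weights with these last two properties. Let $\hat e_i=\tilde w_i-\frac1N\sum_j\tilde w_j$, and let $L_{G_k}$ be the Laplacian matrix of $G_k$. **Theorem 4.** The modified dispatch problem has a unique solution $P^*$, and: 1. For every switching signal and all admissible initial data the protocol has a unique solution on $[0,\infty)$. 2. Along every such solution, $P(t)\in\mathcal F$ for all $t\ge0$ (capacity limits and supply-demand balance always hold), $\tilde w_i-\tilde w_j\to0$ for all $i,j$, $P(t)\to P^*$, and the weights $a_{ij}(t)$ converge to admissible weights. 3. For all admissible weights $a^*$, the equilibrium $(P^*,a^*)$ is Lyapunov stable with respect to admissible initial data, uniformly in the switching signal. 4. The consensus error is exponentially stable: for all $\mu,\alpha>0$ there are $K,r>0$ with $\|\hat e(t)\|\le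 Ke^{-rt}\|\hat e(0)\|$ for all $t\ge0$, all switching signals and all solutions with admissible initial data such that $P_i^{\min}+\mu\le P_i(0)\le P_i^{\max}-\mu$ for all $i$ and $a_{ij}(0)\ge\alpha$ on all links of all $G_k$. 5. There is a common Lyapunov function for all modes: for all $\gamma,\theta_0>0$ and $\theta_{ij}=\theta_{ji}$ with $\theta_{ij}\ge\theta_0$ on all links of all $G_k$, the function $$V(P,a)=\gamma\sum_i\big(C_i^\delta(P_i)-C_i^\delta(P_i^*)\big)+\sum_{(i,j)}\frac{\gamma}{4\beta_{ij}}(\theta_{ij}-a_{ij})^2,$$ where the second sum is over the ordered pairs $(i,j)$ that are linked in some $G_k$, is nonnegative for $P\in\mathcal F$, vanishes there exactly when $P=P^*$ and $a_{ij}=\theta_{ij}$ on all these links, and along every solution with admissible initial data its right derivative satisfies $\dot V\le-\gamma\theta_0\,\hat e^TL_{G_{s(t)}}\hat e\le0$ for all $t\ge0$. -/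

import Mathlib

open Set Filter Topology

noncomputable section

/-- Data of one generating unit: the coefficients of its quadratic cost
`a + b * p + c * p ^ 2` and its capacity limits. -/
structure Generator where
  a : ℝ
  b : ℝ
  c : ℝ
  pmin : ℝ
  pmax : ℝ

/-- The cost of a generator, modified by a logarithmic barrier with parameter `δ`.
It is only used for outputs strictly between the capacity limits. -/
def Generator.barrierCost (g : Generator) (δ p : ℝ) : ℝ :=
  g.a + g.b * p + g.c * p ^ 2 - δ * (Real.log (p - g.pmin) + Real.log (g.pmax - p))

/-- The modified incremental cost. -/
def Generator.incrementalCost (g : Generator) (δ p : ℝ) : ℝ :=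
  g.b + 2 * g.c * p - δ / (p - g.pmin) + δ / (g.pmax - p)

/-- Within the capacity limits, the modified incremental cost is the derivative of the
barrier-modified cost. -/
theorem Generator.hasDerivAt_barrierCost (g : Generator) (δ : ℝ) {p : ℝ}
    (h₁ : g.pmin < p) (h₂ : p < g.pmax) :
    HasDerivAt (g.barrierCost δ) (g.incrementalCost δ p) p := by
  have e₁ : p - g.pmin ≠ 0 := (sub_pos.2 h₁).ne'
  have e₂ : g.pmax - p ≠ 0 := (sub_pos.2 h₂).ne'
  have d₁ := ((hasDerivAt_id p).sub_const g.pmin).log e₁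
  have d₂ := ((hasDerivAt_id p).const_sub g.pmax).log e₂
  have d₃ := (((hasDerivAt_id p).const_mul g.b).const_add g.a).add
    (((hasDerivAt_id p).pow 2).const_mul g.c)
  have d := d₃.sub ((d₁.add d₂).const_mul δ)
  refine (d.congr_deriv ?_)
  simp [Generator.incrementalCost]
  ring

variable {N M : ℕ}

/-- The dispatches that lie strictly within the capacity limits (the domain of the barrier)
and meet the demand `D`. -/
def dispatchSet (gen : Fin N → Generator) (D : ℝ) : Set (Fin N → ℝ) :=
  {P | (∀ i, (gen i).pmin < P i ∧ P i < (gen i).pmax) ∧ ∑ i, P i = D}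

/-- `P` solves the barrier-modified economic dispatch problem: it minimizes the total
barrier-modified cost among the dispatches that meet the demand. -/
def IsOptimalDispatch (gen : Fin N → Generator) (δ D : ℝ) (P : Fin N → ℝ) : Prop :=
  P ∈ dispatchSet gen D ∧
    IsMinOn (fun Q : Fin N → ℝ => ∑ i, (gen i).barrierCost δ (Q i)) (dispatchSet gen D) P

/-- The vector of modified incremental costs. -/
def incCost (gen : Fin N → Generator) (δ : ℝ) (P : Fin N → ℝ) (i : Fin N) : ℝ :=
  (gen i).incrementalCost δ (P i)

/-- The consensus error: the deviation of the modified incremental costs from their average. -/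
def consensusError (gen : Fin N → Generator) (δ : ℝ) (P : Fin N → ℝ) (i : Fin N) : ℝ :=
  incCost gen δ P i - (∑ j, incCost gen δ P j) / N

/-- A switching signal on `[0, ∞)` with values in a finite set of modes: right-continuous and
piecewise constant, with finitely many switches in every bounded interval (equivalently, by
compactness: locally constant to the right of each time and to the left of each time). -/
def IsSwitchingSignal (s : ℝ → Fin M) : Prop :=
  (∀ t, 0 ≤ t → ∀ᶠ τ in 𝓝[>] t, s τ = s t) ∧
    ∀ t, 0 < t → ∃ k, ∀ᶠ τ in 𝓝[<] t, s τ = k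

/-- Coupling weights that are symmetric and positive on every link of every graph. -/
def AdmissibleWeights (G : Fin M → SimpleGraph (Fin N)) (A : Fin N → Fin N → ℝ) : Prop :=
  (∀ i j, A i j = A j i) ∧ ∀ k i j, (G k).Adj i j → 0 < A i j

open Classical in
/-- `(P, A)` is a solution on `[0, ∞)` of the adaptive protocol over the switching topology
`t ↦ G (s t)`. Only the links of the current graph are used and adapted; the stored weight of a
link that is down is held. Both are continuous, and the differential equations hold for right
derivatives at every time, hence in the usual sense between switches. -/
structure IsProtocolSolution (gen : Fin N → Generator) (δ : ℝ) (β : Fin N → Fin N → ℝ)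
    (G : Fin M → SimpleGraph (Fin N)) (s : ℝ → Fin M)
    (P : ℝ → Fin N → ℝ) (A : ℝ → Fin N → Fin N → ℝ) : Prop where
  continuousOn_power : ∀ i, ContinuousOn (fun t => P t i) (Ici 0)
  continuousOn_weight : ∀ i j, ContinuousOn (fun t => A t i j) (Ici 0)
  power_deriv : ∀ t, 0 ≤ t → ∀ i, HasDerivWithinAt (fun τ => P τ i)
    (∑ j, if (G (s t)).Adj i j then
      A t i j * (incCost gen δ (P t) j - incCost gen δ (P t) i) else 0) (Ici t) t
  weight_deriv : ∀ t, 0 ≤ t → ∀ i j, HasDerivWithinAt (fun τ => A τ i j)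
    (if (G (s t)).Adj i j then
      β i j * (incCost gen δ (P t) i - incCost gen δ (P t) j) ^ 2 else 0) (Ici t) t

open Classical in
/-- The quadratic form `eᵀ L e` of the Laplacian `L` of a graph. -/
def laplacianForm (H : SimpleGraph (Fin N)) (e : Fin N → ℝ) : ℝ :=
  e ⬝ᵥ (H.lapMatrix ℝ).mulVec e

open Classical in
/-- The energy of a state `(P, A)` relative to the dispatch `Q` and the target weights `θ`: the
excess of the total barrier-modified cost plus the weighted squared deviation of the weights
over the links that occur in some graph of the family, scaled by `γ`. -/
def energy (gen : Fin N → Generator) (δ : ℝ) (β : Fin N → Fin N → ℝ)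
    (G : Fin M → SimpleGraph (Fin N)) (γ : ℝ) (θ : Fin N → Fin N → ℝ) (Q : Fin N → ℝ)
    (P : Fin N → ℝ) (A : Fin N → Fin N → ℝ) : ℝ :=
  γ * ∑ i, ((gen i).barrierCost δ (P i) - (gen i).barrierCost δ (Q i)) +
    ∑ i, ∑ j, if ∃ k, (G k).Adj i j then γ / (4 * β i j) * (θ i j - A i j) ^ 2 else 0

end

/-
The barrier cost plays the role of a Lyapunov function: along the protocol it dissipates the
Dirichlet form of the incremental costs on the active graph, weighted by the current weights.
Since the cost blows up at the capacity limits, its sublevel sets keep the powers in a compact box,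
and the same cost bounds the total drift of the weights, so solutions are global.  The weights never
decrease, hence a Poincaré inequality on connected graphs together with strong convexity of the
costs gives exponential decay of the excess cost at a rate that does not depend on the switching.
Adding the adaptation energy replaces the current weights in the dissipation by constant target
weights, which yields one Lyapunov function for all modes.
-/

theorem le_of_right_deriv_nonpos {f f' : ℝ → ℝ} {a b : ℝ} (hab : a ≤ b)
    (hf : ContinuousOn f (Icc a b))
    (hf' : ∀ x ∈ Ico a b, HasDerivWithinAt f (f' x) (Ici x) x)
    (hneg : ∀ x ∈ Ico a b, f' x ≤ 0) : f b ≤ f a :=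
  image_le_of_deriv_right_le_deriv_boundary (B := fun _ => f a) (B' := fun _ => 0) hf hf' le_rfl
    continuousOn_const (fun _ _ => hasDerivWithinAt_const _ _ _) hneg (right_mem_Icc.2 hab)

theorem exp_decay_of_right_deriv_le {f f' : ℝ → ℝ} {r b : ℝ} (hb : 0 ≤ b)
    (hf : ContinuousOn f (Icc 0 b))
    (hf' : ∀ x ∈ Ico 0 b, HasDerivWithinAt f (f' x) (Ici x) x)
    (hle : ∀ x ∈ Ico 0 b, f' x ≤ -r * f x) : f b ≤ f 0 * Real.exp (-r * b) := by
  have h := le_gronwallBound_of_liminf_deriv_right_le hf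
    (fun x hx _ hr => (hf' x hx).liminf_right_slope_le hr) le_rfl
    (fun x hx => (hle x hx).trans_eq (add_zero _).symm) b (right_mem_Icc.2 hb)
  rwa [gronwallBound_ε0, sub_zero] at h

theorem continuation_principle {p : ℝ → Prop} (zero : p 0)
    (mono : ∀ t u, 0 ≤ t → t ≤ u → p u → p t)
    (left : ∀ t, 0 < t → (∀ u ∈ Ico 0 t, p u) → p t)
    (right : ∀ t, 0 ≤ t → p t → ∃ u > t, p u) : ∀ t, 0 ≤ t → p t := by
  by_contra! ⟨b, hb₀, hb⟩
  set B : Set ℝ := {t | 0 ≤ t ∧ ¬ p t}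
  have bdd : BddBelow B := ⟨0, fun _ ht => ht.1⟩
  have ne : B.Nonempty := ⟨b, hb₀, hb⟩
  have inf_nonneg : 0 ≤ sInf B := le_csInf ne fun _ ht => ht.1
  have of_lt : ∀ u ∈ Ico 0 (sInf B), p u := fun u hu => by
    by_contra hpu
    exact (csInf_le bdd ⟨hu.1, hpu⟩).not_gt hu.2
  have at_inf : p (sInf B) := by
    rcases inf_nonneg.eq_or_lt with h | h
    · rwa [← h]
    · exact left _ h of_lt
  obtain ⟨u, hu, hpu⟩ := right _ inf_nonneg at_inf
  obtain ⟨t, ht, htu⟩ := exists_lt_of_csInf_lt ne hu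
  exact ht.2 (mono t u ht.1 htu.le hpu)

theorem mem_of_forward_invariant {E : Type*} [TopologicalSpace E] {f : ℝ → E} {U K : Set E}
    (hf : ContinuousOn f (Ici 0)) (hU : IsOpen U) (hK : IsClosed K) (hKU : K ⊆ U)
    (h₀ : f 0 ∈ U) (h : ∀ T, 0 ≤ T → (∀ t ∈ Icc 0 T, f t ∈ U) → f T ∈ K) :
    ∀ t, 0 ≤ t → f t ∈ K := by
  have stays : ∀ T, 0 ≤ T → ∀ t ∈ Icc 0 T, f t ∈ U := by
    refine continuation_principle ?_ ?_ ?_ ?_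
    · rintro t ⟨ht₁, ht₂⟩
      rwa [le_antisymm ht₂ ht₁]
    · exact fun t u _ htu hu τ hτ => hu τ ⟨hτ.1, hτ.2.trans htu⟩
    · intro t ht hlt
      have hmem : f t ∈ closure K :=
        ((hf t ht.le).mono Ico_subset_Ici_self).mem_closure
          (by rw [closure_Ico ht.ne]; exact right_mem_Icc.2 ht.le) fun τ hτ => h τ hτ.1 (hlt τ hτ)
      intro τ hτ
      rcases hτ.2.eq_or_lt with rfl | hτt
      · exact hKU (hK.closure_eq ▸ hmem)
      · exact hlt τ ⟨hτ.1, hτt⟩ τ ⟨hτ.1, le_rfl⟩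
    · intro t ht hIcc
      have hnhds : ∀ᶠ τ in 𝓝[≥] t, f τ ∈ U :=
        ((hf t ht).mono (Ici_subset_Ici.2 ht)).eventually
          (hU.mem_nhds (hIcc t ⟨ht, le_rfl⟩))
      obtain ⟨u, hu, hu'⟩ := mem_nhdsGE_iff_exists_Icc_subset.1 hnhds
      refine ⟨u, hu, fun τ hτ => ?_⟩
      rcases le_total τ t with h | h
      · exact hIcc τ ⟨hτ.1, h⟩
      · exact hu' ⟨h, hτ.2⟩
  exact fun t ht => h t ht (stays t ht)

theorem tendsto_zero_of_mul_sq_le_mul_exp {f : ℝ → ℝ} {c C r : ℝ} (hc : 0 < c) (hr : 0 < r)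
    (h : ∀ t, 0 ≤ t → c * f t ^ 2 ≤ C * Real.exp (-r * t)) : Tendsto f atTop (𝓝 0) := by
  have bound : Tendsto (fun t : ℝ => C / c * Real.exp (-r * t)) atTop (𝓝 0) := by
    simpa only [Function.comp_def, mul_zero, id] using (Real.tendsto_exp_atBot.comp
      (tendsto_id.const_mul_atTop_of_neg (neg_lt_zero.2 hr))).const_mul (C / c)
  have sq : Tendsto (fun t => f t ^ 2) atTop (𝓝 0) := by
    refine squeeze_zero' (Eventually.of_forall fun t => sq_nonneg _) ?_ bound
    filter_upwards [eventually_ge_atTop 0] with t ht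
    rw [div_mul_eq_mul_div, le_div_iff₀' hc]
    exact h t ht
  refine (tendsto_zero_iff_abs_tendsto_zero f).2 ?_
  simpa only [Real.sqrt_sq_eq_abs, Real.sqrt_zero] using! sq.sqrt

theorem exists_tendsto_of_monotoneOn_Ici {f : ℝ → ℝ} {a C : ℝ} (hf : MonotoneOn f (Ici a))
    (hC : ∀ t, a ≤ t → f t ≤ C) : ∃ l, Tendsto f atTop (𝓝 l) ∧ f a ≤ l := by
  have mono : Monotone fun t => f (max a t) := fun t u htu =>
    hf (le_max_left a t) (le_max_left a u) (max_le_max_left a htu)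
  have bdd : BddAbove (range fun t => f (max a t)) :=
    ⟨C, forall_mem_range.2 fun t => hC _ (le_max_left a t)⟩
  refine ⟨_, (tendsto_atTop_ciSup mono bdd).congr' ?_, ?_⟩
  · filter_upwards [eventually_ge_atTop a] with t ht
    rw [max_eq_right ht]
  · simpa only [max_self] using le_ciSup bdd a

section SwitchedODE

variable {E ι : Type*} [NormedAddCommGroup E] [NormedSpace ℝ E] {v : ι → E → E} {s : ℝ → ι}
  {U K : Set E} {x₀ : E}

/-- `f` solves the switched differential equation `f' = v (s t) f` on `[0, T]`, in the sense of
right derivatives, and stays in `U`. -/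
structure IsSwitchedSolution (v : ι → E → E) (s : ℝ → ι) (U : Set E) (T : ℝ) (f : ℝ → E) :
    Prop where
  continuousOn : ContinuousOn f (Icc 0 T)
  hasDerivWithinAt : ∀ t ∈ Ico 0 T, HasDerivWithinAt f (v (s t) (f t)) (Ici t) t
  mem : ∀ t ∈ Icc 0 T, f t ∈ U

theorem IsSwitchedSolution.mono {T T' : ℝ} {f : ℝ → E} (h : IsSwitchedSolution v s U T f)
    (hT : T' ≤ T) : IsSwitchedSolution v s U T' f :=
  ⟨h.continuousOn.mono (Icc_subset_Icc_right hT),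
    fun t ht => h.hasDerivWithinAt t ⟨ht.1, ht.2.trans_le hT⟩,
    fun t ht => h.mem t ⟨ht.1, ht.2.trans hT⟩⟩

theorem exists_lipschitzOnWith_of_contDiffOn_of_isCompact [Finite ι] (hU : IsOpen U)
    (hv : ∀ k, ContDiffOn ℝ 1 (v k) U) (hK : IsCompact K) (hKU : K ⊆ U) :
    ∃ L, ∀ k, LipschitzOnWith L (v k) K := by
  have loc : ∀ k, LocallyLipschitzOn K (v k) := fun k x hx => by
    obtain ⟨L, W, hW, hL⟩ := ((hv k).contDiffAt (hU.mem_nhds (hKU hx))).exists_lipschitzOnWith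
    exact ⟨L, W, mem_nhdsWithin_of_mem_nhds hW, hL⟩
  choose L hL using fun k => (loc k).exists_lipschitzOnWith_of_compact hK
  obtain ⟨L', hL'⟩ := Set.finite_range L |>.bddAbove
  exact ⟨L', fun k => (hL k).weaken (hL' ⟨k, rfl⟩)⟩

theorem IsSwitchedSolution.eqOn [Finite ι] (hU : IsOpen U) (hv : ∀ k, ContDiffOn ℝ 1 (v k) U)
    {T : ℝ} {f g : ℝ → E} (hf : IsSwitchedSolution v s U T f)
    (hg : IsSwitchedSolution v s U T g) (h₀ : f 0 = g 0) : EqOn f g (Icc 0 T) := by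
  have compact : IsCompact (f '' Icc 0 T ∪ g '' Icc 0 T) :=
    (isCompact_Icc.image_of_continuousOn hf.continuousOn).union
      (isCompact_Icc.image_of_continuousOn hg.continuousOn)
  obtain ⟨L, hL⟩ := exists_lipschitzOnWith_of_contDiffOn_of_isCompact hU hv compact
    (union_subset (image_subset_iff.2 hf.mem) (image_subset_iff.2 hg.mem))
  exact ODE_solution_unique_of_mem_Icc_right (fun t _ => hL (s t))
    hf.continuousOn hf.hasDerivWithinAt
    (fun t ht => Or.inl (mem_image_of_mem f (Ico_subset_Icc_self ht)))
    hg.continuousOn hg.hasDerivWithinAt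
    (fun t ht => Or.inr (mem_image_of_mem g (Ico_subset_Icc_self ht))) h₀

/-- The equation `f' = w f` has a solution on `[0, ε]` that starts at `x` and stays in `U`. -/
def HasIntegralCurveIn (w : E → E) (U : Set E) (x : E) (ε : ℝ) : Prop :=
  ∃ f : ℝ → E, f 0 = x ∧ IsIntegralCurveOn f (fun _ => w) (Icc 0 ε) ∧ ∀ t ∈ Icc 0 ε, f t ∈ U

theorem HasIntegralCurveIn.mono {w : E → E} {x : E} {ε ε' : ℝ}
    (h : HasIntegralCurveIn w U x ε) (hε : ε' ≤ ε) : HasIntegralCurveIn w U x ε' :=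
  let ⟨f, hf₀, hf, hfU⟩ := h
  have hsub : Icc 0 ε' ⊆ Icc 0 ε := Icc_subset_Icc_right hε
  ⟨f, hf₀, hf.mono hsub, fun t ht => hfU t (hsub ht)⟩

theorem IsSwitchedSolution.extend {T₁ T₂ ε : ℝ} {f : ℝ → E} (hf : IsSwitchedSolution v s U T₁ f)
    {k : ι} (hcurve : HasIntegralCurveIn (v k) U (f T₁) ε) (hT₁ : 0 ≤ T₁) (hT : T₁ ≤ T₂)
    (hε : T₂ ≤ T₁ + ε) (hk : ∀ t ∈ Ico T₁ T₂, s t = k) :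
    ∃ g, g 0 = f 0 ∧ IsSwitchedSolution v s U T₂ g := by
  obtain ⟨u, hu₀, hu, huU⟩ := hcurve.mono (sub_le_iff_le_add'.2 hε)
  have shift : IsIntegralCurveOn (fun t => u (t - T₁)) (fun _ => v k) (Icc T₁ T₂) := by
    simpa [Function.comp_def] using! hu.comp_sub T₁
  set g : ℝ → E := fun t => if t ≤ T₁ then f t else u (t - T₁)
  have eq_f : ∀ t ≤ T₁, g t = f t := fun t ht => if_pos ht
  have eq_u : ∀ t, T₁ ≤ t → g t = u (t - T₁) := fun t ht => by
    rcases ht.eq_or_lt with rfl | hlt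
    · simp [g, hu₀]
    · simp [g, hlt]
  refine ⟨g, eq_f 0 hT₁, ?_, fun t ht => ?_, fun t ht => ?_⟩
  · rw [← Icc_union_Icc_eq_Icc hT₁ hT]
    exact (hf.continuousOn.congr fun t ht => eq_f t ht.2).union_of_isClosed
      (shift.continuousOn.congr fun t ht => eq_u t ht.1) isClosed_Icc isClosed_Icc
  · rcases lt_or_ge t T₁ with hlt | hge
    · rw [eq_f t hlt.le]
      refine (hf.hasDerivWithinAt t ⟨ht.1, hlt⟩).congr_of_eventuallyEq ?_ (eq_f t hlt.le)
      filter_upwards [mem_nhdsWithin_of_mem_nhds (Iic_mem_nhds hlt)] with τ hτ using eq_f τ hτ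
    · rw [eq_u t hge, hk t ⟨hge, ht.2⟩]
      refine ((shift t ⟨hge, ht.2.le⟩).mono_of_mem_nhdsWithin ?_).congr
        (fun τ hτ => eq_u τ (hge.trans hτ)) (eq_u t hge)
      exact mem_of_superset (Icc_mem_nhdsGE ht.2) (Icc_subset_Icc_left hge)
  · rcases le_total t T₁ with hle | hge
    · exact eq_f t hle ▸ hf.mem t ⟨ht.1, hle⟩
    · exact eq_u t hge ▸ huU _ ⟨sub_nonneg.2 hge, sub_le_sub_right ht.2 T₁⟩

variable [CompleteSpace E]

theorem eventually_hasIntegralCurveIn {w : E → E} (hU : IsOpen U) (hw : ContDiffOn ℝ 1 w U)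
    (hx₀ : x₀ ∈ U) : ∃ ε > 0, ∀ᶠ x in 𝓝 x₀, HasIntegralCurveIn w U x ε := by
  obtain ⟨ε, hε, a, r, _, _, hr, hpl⟩ :=
    IsPicardLindelof.of_contDiffAt_one (hw.contDiffAt (hU.mem_nhds hx₀))
  obtain ⟨α, hα, hcont⟩ := (hpl 0).exists_forall_mem_closedBall_eq_hasDerivWithinAt_continuousOn
  simp only [zero_sub, zero_add] at hα hcont
  have ball_mem : Metric.closedBall x₀ r ∈ 𝓝 x₀ := Metric.closedBall_mem_nhds x₀ hr
  have flow_mem : ∀ᶠ y in 𝓝 (x₀, (0 : ℝ)), α y ∈ U := by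
    refine (hcont.continuousAt (prod_mem_nhds ball_mem (Icc_mem_nhds (by linarith) hε))).eventually
      (hU.mem_nhds ?_)
    rwa [(hα x₀ (Metric.mem_closedBall_self r.2)).1]
  obtain ⟨W, hW, J, hJ, hWJ⟩ := mem_nhds_prod_iff.1 flow_mem
  obtain ⟨η, hη, hηJ⟩ := mem_nhdsGE_iff_exists_Icc_subset.1 (mem_nhdsWithin_of_mem_nhds hJ)
  refine ⟨min η ε, lt_min hη hε, ?_⟩
  filter_upwards [hW, ball_mem] with x hxW hx
  have hsub : Icc 0 (min η ε) ⊆ Icc (-ε) ε := Icc_subset_Icc (by linarith) (min_le_right _ _)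
  exact ⟨fun t => α (x, t), (hα x hx).1, fun t ht => ((hα x hx).2 t (hsub ht)).mono hsub,
    fun t ht => hWJ ⟨hxW, hηJ ⟨ht.1, ht.2.trans (min_le_left _ _)⟩⟩⟩

theorem exists_forall_hasIntegralCurveIn {w : E → E} (hU : IsOpen U) (hw : ContDiffOn ℝ 1 w U)
    (hK : IsCompact K) (hKU : K ⊆ U) : ∃ ε > 0, ∀ x ∈ K, HasIntegralCurveIn w U x ε := by
  refine hK.induction_on (p := fun S => ∃ ε > 0, ∀ x ∈ S, HasIntegralCurveIn w U x ε)
    ⟨1, one_pos, fun _ hx => absurd hx (notMem_empty _)⟩ ?_ ?_ fun x hx => ?_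
  · rintro S S' hS ⟨ε, hε, h⟩
    exact ⟨ε, hε, fun x hx => h x (hS hx)⟩
  · rintro S S' ⟨ε, hε, h⟩ ⟨ε', hε', h'⟩
    exact ⟨min ε ε', lt_min hε hε', fun x hx => hx.elim
      (fun hx => (h x hx).mono (min_le_left _ _)) fun hx => (h' x hx).mono (min_le_right _ _)⟩
  · obtain ⟨ε, hε, h⟩ := eventually_hasIntegralCurveIn hU hw (hKU hx)
    exact ⟨_, mem_nhdsWithin_of_mem_nhds h, ε, hε, fun _ => id⟩

theorem exists_isSwitchedSolution (hU : IsOpen U) (hv : ∀ k, ContDiffOn ℝ 1 (v k) U)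
    (hK : IsCompact K) (hKU : K ⊆ U) (hx₀ : x₀ ∈ U)
    (apriori : ∀ T f, 0 ≤ T → IsSwitchedSolution v s U T f → f 0 = x₀ → f T ∈ K)
    (hright : ∀ t, 0 ≤ t → ∀ᶠ τ in 𝓝[>] t, s τ = s t)
    (hleft : ∀ t, 0 < t → ∃ k, ∀ᶠ τ in 𝓝[<] t, s τ = k) :
    ∀ T, 0 ≤ T → ∃ f, f 0 = x₀ ∧ IsSwitchedSolution v s U T f := by
  choose ε hε hlocal using fun k => exists_forall_hasIntegralCurveIn hU (hv k) hK hKU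
  refine continuation_principle ?_ ?_ ?_ ?_
  · exact ⟨fun _ => x₀, rfl, continuousOn_const,
      fun t ht => absurd (ht.1.trans_lt ht.2) (lt_irrefl _), fun _ _ => hx₀⟩
  · exact fun t u _ htu ⟨f, hf₀, hf⟩ => ⟨f, hf₀, hf.mono htu⟩
  · intro t ht hlt
    obtain ⟨k, hk⟩ := hleft t ht
    obtain ⟨l, hl, hlk⟩ := mem_nhdsLT_iff_exists_Ico_subset.1 hk
    set a := max 0 (max l (t - ε k))
    have ha₀ : 0 ≤ a := le_max_left _ _
    have hla : l ≤ a := (le_max_left _ _).trans (le_max_right _ _)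
    have hta : t - ε k ≤ a := (le_max_right _ _).trans (le_max_right _ _)
    have hat : a < t := max_lt ht (max_lt hl (sub_lt_self _ (hε k)))
    obtain ⟨f, hf₀, hf⟩ := hlt a ⟨ha₀, hat⟩
    obtain ⟨g, hg₀, hg⟩ := hf.extend (hlocal k _ (apriori a f ha₀ hf hf₀)) ha₀ hat.le
      (sub_le_iff_le_add.1 hta) fun τ hτ => hlk ⟨hla.trans hτ.1, hτ.2⟩
    exact ⟨g, hg₀.trans hf₀, hg⟩
  · rintro t ht ⟨f, hf₀, hf⟩
    obtain ⟨u, hu, hus⟩ := mem_nhdsGT_iff_exists_Ioo_subset.1 (hright t ht)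
    have hb : t < min u (t + ε (s t)) := lt_min hu (lt_add_of_pos_right t (hε _))
    obtain ⟨g, hg₀, hg⟩ := hf.extend (hlocal (s t) _ (apriori t f ht hf hf₀)) ht hb.le
      (min_le_right _ _) fun τ hτ => by
        rcases hτ.1.eq_or_lt with rfl | hlt
        · rfl
        · exact hus ⟨hlt, hτ.2.trans_le (min_le_left _ _)⟩
    exact ⟨_, hb, g, hg₀.trans hf₀, hg⟩

theorem exists_global_isSwitchedSolution [Finite ι] (hU : IsOpen U)
    (hv : ∀ k, ContDiffOn ℝ 1 (v k) U) (hK : IsCompact K) (hKU : K ⊆ U) (hx₀ : x₀ ∈ U)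
    (apriori : ∀ T f, 0 ≤ T → IsSwitchedSolution v s U T f → f 0 = x₀ → f T ∈ K)
    (hright : ∀ t, 0 ≤ t → ∀ᶠ τ in 𝓝[>] t, s τ = s t)
    (hleft : ∀ t, 0 < t → ∃ k, ∀ᶠ τ in 𝓝[<] t, s τ = k) :
    ∃ f, f 0 = x₀ ∧ ContinuousOn f (Ici 0) ∧
      (∀ t, 0 ≤ t → HasDerivWithinAt f (v (s t) (f t)) (Ici t) t) ∧ ∀ t, 0 ≤ t → f t ∈ U := by
  choose g hg₀ hg using fun n : ℕ =>
    exists_isSwitchedSolution hU hv hK hKU hx₀ apriori hright hleft n n.cast_nonneg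
  have agree : ∀ n : ℕ, EqOn (fun t => g ⌈t⌉₊ t) (g n) (Icc 0 n) := fun n t ht =>
    (hg _).eqOn hU hv ((hg n).mono (Nat.cast_le.2 (Nat.ceil_le.2 ht.2)))
      ((hg₀ _).trans (hg₀ n).symm) ⟨ht.1, Nat.le_ceil t⟩
  have lt_succ : ∀ t : ℝ, t < (⌈t⌉₊ + 1 : ℕ) := fun t =>
    (Nat.le_ceil t).trans_lt (Nat.cast_lt.2 (Nat.lt_succ_self _))
  refine ⟨fun t => g ⌈t⌉₊ t, by simp [hg₀], fun t ht => ?_, fun t ht => ?_,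
    fun t ht => (hg ⌈t⌉₊).mem t ⟨ht, Nat.le_ceil t⟩⟩
  · refine (((hg _).continuousOn.congr (agree _)) t ⟨ht, (lt_succ t).le⟩).mono_of_mem_nhdsWithin ?_
    rw [← Ici_inter_Iic]
    exact inter_mem self_mem_nhdsWithin (mem_nhdsWithin_of_mem_nhds (Iic_mem_nhds (lt_succ t)))
  · have hval := agree (⌈t⌉₊ + 1) ⟨ht, (lt_succ t).le⟩
    simp only at hval
    simp only [hval]
    refine ((hg _).hasDerivWithinAt t ⟨ht, lt_succ t⟩).congr_of_eventuallyEq ?_ hval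
    filter_upwards [Icc_mem_nhdsGE (lt_succ t)] with τ hτ using agree _ ⟨ht.trans hτ.1, hτ.2⟩

end SwitchedODE

section Graph

variable {V : Type*} [Fintype V] {H : SimpleGraph V} {A B : V → V → ℝ} {w : V → ℝ}

open Classical in
/-- The consensus coupling: the rate of change of the node `i` when every link `ij` of `H` carries
the flow `A i j * (w j - w i)` into `i`. -/
noncomputable def coupling (H : SimpleGraph V) (A : V → V → ℝ) (w : V → ℝ) (i : V) : ℝ :=
  ∑ j, if H.Adj i j then A i j * (w j - w i) else 0

open Classical in
/-- The Dirichlet form of the graph `H` with link weights `A`; the factor `1 / 2` makes up for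
each link being counted in both directions. -/
noncomputable def dirichletForm (H : SimpleGraph V) (A : V → V → ℝ) (w : V → ℝ) : ℝ :=
  (1 / 2) * ∑ i, ∑ j, if H.Adj i j then A i j * (w i - w j) ^ 2 else 0

open Classical in
theorem sum_mul_coupling_eq (u : V → ℝ) (hA : ∀ i j, A i j = A j i) :
    ∑ i, u i * coupling H A w i =
      -((1 / 2) * ∑ i, ∑ j, if H.Adj i j then A i j * ((u i - u j) * (w i - w j)) else 0) := by
  set F : V → V → ℝ := fun i j => u i * if H.Adj i j then A i j * (w j - w i) else 0
  have symmetrize : 2 * ∑ i, ∑ j, F i j = ∑ i, ∑ j, (F i j + F j i) := by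
    simp only [Finset.sum_add_distrib]
    rw [Finset.sum_comm (f := fun i j => F j i), two_mul]
  have hF : ∀ i j, F i j + F j i =
      -if H.Adj i j then A i j * ((u i - u j) * (w i - w j)) else 0 := fun i j => by
    simp only [F, H.adj_comm j i, hA j i]
    split_ifs <;> ring
  simp only [hF, Finset.sum_neg_distrib] at symmetrize
  have rows : ∑ i, u i * coupling H A w i = ∑ i, ∑ j, F i j := by
    simp only [coupling, Finset.mul_sum, F]
  linarith

theorem sum_coupling (hA : ∀ i j, A i j = A j i) : ∑ i, coupling H A w i = 0 := by
  simpa using sum_mul_coupling_eq (H := H) (w := w) (fun _ => 1) hA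

theorem sum_mul_coupling (hA : ∀ i j, A i j = A j i) :
    ∑ i, w i * coupling H A w i = -dirichletForm H A w := by
  simp only [sum_mul_coupling_eq w hA, dirichletForm, sq]

theorem dirichletForm_mono (hAB : ∀ i j, H.Adj i j → A i j ≤ B i j) :
    dirichletForm H A w ≤ dirichletForm H B w := by
  classical
  refine mul_le_mul_of_nonneg_left (Finset.sum_le_sum fun i _ => Finset.sum_le_sum fun j _ => ?_)
    one_half_pos.le
  split_ifs with hij
  · exact mul_le_mul_of_nonneg_right (hAB i j hij) (sq_nonneg _)
  · exact le_rfl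

theorem dirichletForm_sub (A B : V → V → ℝ) :
    dirichletForm H (A - B) w = dirichletForm H A w - dirichletForm H B w := by
  classical
  simp only [dirichletForm, ← mul_sub, ← Finset.sum_sub_distrib]
  refine congrArg _ (Finset.sum_congr rfl fun i _ => Finset.sum_congr rfl fun j _ => ?_)
  split_ifs
  · exact sub_mul _ _ _
  · exact (sub_self 0).symm

theorem dirichletForm_const (c : ℝ) :
    dirichletForm H (fun _ _ => c) w = c * dirichletForm H (fun _ _ => 1) w := by
  classical
  simp only [dirichletForm, Finset.mul_sum, mul_ite, mul_zero]
  refine Finset.sum_congr rfl fun i _ => Finset.sum_congr rfl fun j _ => ?_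
  split_ifs <;> ring

theorem mul_dirichletForm_one_le {c : ℝ} (hA : ∀ i j, H.Adj i j → c ≤ A i j) :
    c * dirichletForm H (fun _ _ => 1) w ≤ dirichletForm H A w :=
  (dirichletForm_const c).ge.trans (dirichletForm_mono hA)

theorem dirichletForm_nonneg (hA : ∀ i j, H.Adj i j → 0 ≤ A i j) : 0 ≤ dirichletForm H A w := by
  simpa using mul_dirichletForm_one_le (w := w) hA

theorem dirichletForm_sub_const (c : ℝ) :
    dirichletForm H A (fun i => w i - c) = dirichletForm H A w := by
  simp only [dirichletForm, sub_sub_sub_cancel_right]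

theorem sq_sub_le_dirichletForm_one {u v : V} (huv : H.Adj u v) :
    (w u - w v) ^ 2 ≤ dirichletForm H (fun _ _ => 1) w := by
  classical
  set F : V → V → ℝ := fun i j => if H.Adj i j then 1 * (w i - w j) ^ 2 else 0 with hF
  have nonneg : ∀ i j, 0 ≤ F i j := fun i j => by
    simp only [hF]
    split_ifs <;> positivity
  have row : ∀ i j, F i j ≤ ∑ k, F i k := fun i j =>
    Finset.single_le_sum (fun k _ => nonneg i k) (Finset.mem_univ j)
  have two_rows : ∑ k, F u k + ∑ k, F v k ≤ ∑ i, ∑ k, F i k := by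
    rw [← Finset.sum_pair huv.ne (f := fun i => ∑ k, F i k)]
    exact Finset.sum_le_univ_sum_of_nonneg fun i => Finset.sum_nonneg fun k _ => nonneg i k
  have huv' : F u v = (w u - w v) ^ 2 := by simp [hF, huv]
  have hvu' : F v u = (w u - w v) ^ 2 := by simp [hF, huv.symm, sub_sq_comm (w v)]
  have := row u v
  have := row v u
  change _ ≤ 1 / 2 * ∑ i, ∑ k, F i k
  linarith

theorem abs_sub_le_length_mul_sqrt_dirichletForm {u v : V} (p : H.Walk u v) :
    |w u - w v| ≤ p.length * √(dirichletForm H (fun _ _ => 1) w) := by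
  induction p with
  | nil => simp
  | cons huv p ih =>
    rw [SimpleGraph.Walk.length_cons, Nat.cast_succ, add_mul, one_mul, add_comm]
    exact (abs_sub_le _ _ _).trans
      (add_le_add (Real.abs_le_sqrt (sq_sub_le_dirichletForm_one huv)) ih)

theorem sq_sub_le_card_sq_mul_dirichletForm (hH : H.Connected) (u v : V) :
    (w u - w v) ^ 2 ≤ (Fintype.card V : ℝ) ^ 2 * dirichletForm H (fun _ _ => 1) w := by
  obtain ⟨p, hp⟩ := hH.exists_isPath u v
  rw [← Real.sq_sqrt (dirichletForm_nonneg (w := w) fun _ _ (_ : H.Adj _ _) => zero_le_one),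
    ← mul_pow, ← sq_abs]
  gcongr
  refine (abs_sub_le_length_mul_sqrt_dirichletForm p).trans ?_
  gcongr
  exact hp.length_lt.le

/-- Poincaré's inequality, with a constant that is common to all connected graphs on `V`. -/
theorem two_mul_sum_sq_le_card_pow_three_mul_dirichletForm (hH : H.Connected)
    (hw : ∑ i, w i = 0) :
    2 * ∑ i, w i ^ 2 ≤ (Fintype.card V : ℝ) ^ 3 * dirichletForm H (fun _ _ => 1) w := by
  set n : ℝ := (Fintype.card V : ℝ)
  set D := dirichletForm H (fun _ _ => 1) w
  have hn : 0 < n := by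
    have := hH.nonempty
    exact Nat.cast_pos.2 Fintype.card_pos
  have expand : ∑ i, ∑ j, (w i - w j) ^ 2 = n * (2 * ∑ i, w i ^ 2) := by
    simp only [sub_sq, Finset.sum_add_distrib, Finset.sum_sub_distrib, Finset.sum_const,
      Finset.card_univ, ← Finset.mul_sum, hw, nsmul_eq_mul, mul_zero, sub_zero]
    ring
  have bound : ∑ i : V, ∑ j, (w i - w j) ^ 2 ≤ ∑ i : V, ∑ j : V, n ^ 2 * D :=
    Finset.sum_le_sum fun i _ => Finset.sum_le_sum fun j _ =>
      sq_sub_le_card_sq_mul_dirichletForm hH i j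
  simp only [Finset.sum_const, Finset.card_univ, nsmul_eq_mul] at bound
  rw [expand] at bound
  exact le_of_mul_le_mul_left (bound.trans_eq (by ring)) hn

end Graph

theorem laplacianForm_eq_dirichletForm {N : ℕ} (H : SimpleGraph (Fin N)) (e : Fin N → ℝ) :
    laplacianForm H e = dirichletForm H (fun _ _ => 1) e := by
  classical
  rw [laplacianForm, ← Matrix.toLinearMap₂'_apply', SimpleGraph.lapMatrix_toLinearMap₂',
    dirichletForm]
  simp only [one_mul, div_eq_inv_mul, mul_one]

theorem log_sub_log_le {x y : ℝ} (hx : 0 < x) (hy : 0 < y) :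
    Real.log x - Real.log y ≤ (x - y) / y := by
  have h := Real.log_le_sub_one_of_pos (div_pos hx hy)
  rw [Real.log_div hx.ne' hy.ne'] at h
  rwa [sub_div, div_self hy.ne']

theorem exists_pos_forall_le {ι : Type*} [Finite ι] {f : ι → ℝ} (hf : ∀ i, 0 < f i) :
    ∃ c, 0 < c ∧ ∀ i, c ≤ f i := by
  rcases isEmpty_or_nonempty ι with _ | _
  · exact ⟨1, one_pos, isEmptyElim⟩
  · obtain ⟨i, hi⟩ := Finite.exists_min f
    exact ⟨f i, hf i, hi⟩

namespace Generator

variable {g : Generator} {δ p q : ℝ}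

theorem incrementalCost_mul_add_le_barrierCost_sub (hδ : 0 ≤ δ) (hp : p ∈ Ioo g.pmin g.pmax)
    (hq : q ∈ Ioo g.pmin g.pmax) :
    g.incrementalCost δ q * (p - q) + g.c * (p - q) ^ 2 ≤
      g.barrierCost δ p - g.barrierCost δ q := by
  have lower := mul_le_mul_of_nonneg_left
    (log_sub_log_le (sub_pos.2 hp.1) (sub_pos.2 hq.1)) hδ
  have upper := mul_le_mul_of_nonneg_left
    (log_sub_log_le (sub_pos.2 hp.2) (sub_pos.2 hq.2)) hδ
  calc g.incrementalCost δ q * (p - q) + g.c * (p - q) ^ 2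
      = g.b * (p - q) + g.c * (p ^ 2 - q ^ 2) -
          δ * ((p - g.pmin - (q - g.pmin)) / (q - g.pmin)) -
          δ * ((g.pmax - p - (g.pmax - q)) / (g.pmax - q)) := by
        unfold incrementalCost
        ring
    _ ≤ g.barrierCost δ p - g.barrierCost δ q := by
        unfold barrierCost
        linarith

theorem contDiffOn_incrementalCost (g : Generator) (δ : ℝ) :
    ContDiffOn ℝ 1 (g.incrementalCost δ) (Ioo g.pmin g.pmax) := by
  unfold incrementalCost
  exact ((by fun_prop : ContDiff ℝ 1 fun p => g.b + 2 * g.c * p).contDiffOn.sub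
    (contDiffOn_const.div (by fun_prop) fun p hp => (sub_pos.2 hp.1).ne')).add
    (contDiffOn_const.div (by fun_prop) fun p hp => (sub_pos.2 hp.2).ne')

/-- A lower bound for the barrier-modified cost: the minimum of the quadratic cost, less
`δ * (pmax - pmin)` because `log x ≤ x`. -/
noncomputable def costFloor (g : Generator) (δ : ℝ) : ℝ :=
  g.a - g.b ^ 2 / (4 * g.c) - δ * (g.pmax - g.pmin)

theorem sub_sq_div_le_quadratic (hc : 0 < g.c) (p : ℝ) :
    g.a - g.b ^ 2 / (4 * g.c) ≤ g.a + g.b * p + g.c * p ^ 2 := by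
  have square : 0 ≤ g.c * (p + g.b / (2 * g.c)) ^ 2 := by positivity
  have expand : g.c * (p + g.b / (2 * g.c)) ^ 2 =
      g.c * p ^ 2 + g.b * p + g.b ^ 2 / (4 * g.c) := by
    field_simp
    ring
  linarith

theorem costFloor_le_barrierCost (hc : 0 < g.c) (hδ : 0 ≤ δ) (hp : p ∈ Ioo g.pmin g.pmax) :
    g.costFloor δ ≤ g.barrierCost δ p := by
  have lower := Real.log_le_self (sub_pos.2 hp.1).le
  have upper := Real.log_le_self (sub_pos.2 hp.2).le
  have logs := mul_le_mul_of_nonneg_left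
    (show Real.log (p - g.pmin) + Real.log (g.pmax - p) ≤ g.pmax - g.pmin by linarith) hδ
  unfold costFloor barrierCost
  linarith [sub_sq_div_le_quadratic hc p]

theorem exp_le_of_barrierCost_le {E : ℝ} (hc : 0 < g.c) (hδ : 0 < δ)
    (hp : p ∈ Ioo g.pmin g.pmax) (hE : g.barrierCost δ p ≤ g.costFloor δ + E) :
    Real.exp (-E / δ) ≤ p - g.pmin ∧ Real.exp (-E / δ) ≤ g.pmax - p := by
  have quadratic := sub_sq_div_le_quadratic hc p
  have exp_le : ∀ x y, 0 < x → 0 < y → y ≤ g.pmax - g.pmin →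
      Real.log x + Real.log y = Real.log (p - g.pmin) + Real.log (g.pmax - p) →
      Real.exp (-E / δ) ≤ x := by
    intro x y hx hy hy' hxy
    rw [← Real.le_log_iff_exp_le hx, div_le_iff₀ hδ]
    have logy := mul_le_mul_of_nonneg_left ((Real.log_le_self hy.le).trans hy') hδ.le
    unfold barrierCost costFloor at hE
    rw [← hxy] at hE
    linarith
  have hp₁ := sub_pos.2 hp.1
  have hp₂ := sub_pos.2 hp.2
  exact ⟨exp_le _ _ hp₁ hp₂ (by linarith) rfl, exp_le _ _ hp₂ hp₁ (by linarith) (add_comm _ _)⟩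

end Generator

section Dispatch

variable {N : ℕ} {gen : Fin N → Generator} {δ D c₀ : ℝ} {P Q : Fin N → ℝ}

/-- The total barrier-modified cost of a dispatch. -/
noncomputable def totalCost (gen : Fin N → Generator) (δ : ℝ) (P : Fin N → ℝ) : ℝ :=
  ∑ i, (gen i).barrierCost δ (P i)

/-- The dispatches strictly within the capacity limits: the domain of the barrier, without the
balance condition of `dispatchSet`. -/
def capacityBox (gen : Fin N → Generator) : Set (Fin N → ℝ) :=
  {P | ∀ i, (gen i).pmin < P i ∧ P i < (gen i).pmax}

/-- The dispatches that keep a distance of at least `m` from the capacity limits. -/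
def marginBox (gen : Fin N → Generator) (m : ℝ) : Set (Fin N → ℝ) :=
  Icc (fun i => (gen i).pmin + m) (fun i => (gen i).pmax - m)

theorem isOpen_capacityBox (gen : Fin N → Generator) : IsOpen (capacityBox gen) := by
  have : capacityBox gen = univ.pi fun i => Ioo (gen i).pmin (gen i).pmax := by
    ext P
    simp only [capacityBox, mem_ofPred_eq, mem_univ_pi, mem_Ioo]
  rw [this]
  exact isOpen_set_pi finite_univ fun i _ => isOpen_Ioo

theorem isCompact_marginBox (gen : Fin N → Generator) (m : ℝ) : IsCompact (marginBox gen m) :=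
  isCompact_Icc

theorem marginBox_subset_capacityBox {m : ℝ} (hm : 0 < m) :
    marginBox gen m ⊆ capacityBox gen := fun _ hP i =>
  ⟨(lt_add_of_pos_right _ hm).trans_le (hP.1 i), (hP.2 i).trans_lt (sub_lt_self _ hm)⟩

theorem exists_marginBox_of_totalCost_le (hc : ∀ i, 0 < (gen i).c) (hδ : 0 < δ) (E : ℝ) :
    ∃ m, 0 < m ∧ ∀ P ∈ capacityBox gen, totalCost gen δ P ≤ E → P ∈ marginBox gen m := by
  refine ⟨Real.exp (-(E - ∑ i, (gen i).costFloor δ) / δ), Real.exp_pos _, fun P hP hE => ?_⟩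
  have single : ∀ i, (gen i).barrierCost δ (P i) - (gen i).costFloor δ ≤
      E - ∑ i, (gen i).costFloor δ := fun i => by
    have h := Finset.single_le_sum
      (f := fun j => (gen j).barrierCost δ (P j) - (gen j).costFloor δ) (s := Finset.univ)
      (fun j _ => sub_nonneg.2 (Generator.costFloor_le_barrierCost (hc j) hδ.le (hP j)))
      (Finset.mem_univ i)
    rw [Finset.sum_sub_distrib] at h
    exact h.trans (sub_le_sub_right hE _)
  have margin := fun i =>
    Generator.exp_le_of_barrierCost_le (hc i) hδ (hP i) (sub_le_iff_le_add'.1 (single i))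
  exact ⟨fun i => le_sub_iff_add_le'.1 (margin i).1, fun i => le_sub_comm.1 (margin i).2⟩

theorem continuousOn_totalCost (gen : Fin N → Generator) (δ : ℝ) :
    ContinuousOn (totalCost gen δ) (capacityBox gen) := fun P hP =>
  tendsto_finsetSum _ fun i _ => ((gen i).hasDerivAt_barrierCost δ (hP i).1 (hP i).2
    |>.continuousAt.comp (f := fun P : Fin N → ℝ => P i)
      (continuousAt_apply i P)).continuousWithinAt

theorem contDiffOn_incCost (gen : Fin N → Generator) (δ : ℝ) :
    ContDiffOn ℝ 1 (incCost gen δ) (capacityBox gen) :=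
  contDiffOn_pi.2 fun i => ((gen i).contDiffOn_incrementalCost δ).comp
    (contDiff_apply ℝ ℝ i).contDiffOn fun _ hP => hP i

theorem exists_isOptimalDispatch (hc : ∀ i, 0 < (gen i).c) (hδ : 0 < δ)
    (hD : (dispatchSet gen D).Nonempty) : ∃ Q, IsOptimalDispatch gen δ D Q := by
  obtain ⟨P₀, hP₀⟩ := hD
  obtain ⟨m, hm, hbox⟩ := exists_marginBox_of_totalCost_le hc hδ (totalCost gen δ P₀)
  have compact : IsCompact (marginBox gen m ∩ {P | ∑ i, P i = D}) :=
    (isCompact_marginBox gen m).inter_right (isClosed_eq (by fun_prop) continuous_const)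
  have hP₀m : P₀ ∈ marginBox gen m := hbox _ hP₀.1 le_rfl
  obtain ⟨Q, hQ, hmin⟩ := compact.exists_isMinOn ⟨P₀, hP₀m, hP₀.2⟩
    ((continuousOn_totalCost gen δ).mono
      (inter_subset_left.trans (marginBox_subset_capacityBox hm)))
  refine ⟨Q, ⟨marginBox_subset_capacityBox hm hQ.1, hQ.2⟩, fun P hP => ?_⟩
  rcases le_total (totalCost gen δ P) (totalCost gen δ P₀) with h | h
  · exact hmin (show P ∈ _ from ⟨hbox _ hP.1 h, hP.2⟩)
  · exact le_trans (hmin (show P₀ ∈ _ from ⟨hP₀m, hP₀.2⟩)) h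

namespace IsOptimalDispatch

theorem totalCost_le (hQ : IsOptimalDispatch gen δ D Q) (hP : P ∈ dispatchSet gen D) :
    totalCost gen δ Q ≤ totalCost gen δ P :=
  hQ.2 hP

theorem sum_incCost_mul_eq_zero (hQ : IsOptimalDispatch gen δ D Q) {d : Fin N → ℝ}
    (hd : ∑ i, d i = 0) : ∑ i, incCost gen δ Q i * d i = 0 := by
  have line : ∀ i, HasDerivAt (fun h : ℝ => Q i + h * d i) (d i) 0 := fun i => by
    simpa using ((hasDerivAt_id (0 : ℝ)).mul_const (d i)).const_add (Q i)
  have deriv : HasDerivAt (fun h : ℝ => totalCost gen δ fun i => Q i + h * d i)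
      (∑ i, incCost gen δ Q i * d i) 0 := by
    refine HasDerivAt.fun_sum fun i _ => ?_
    have cost := (gen i).hasDerivAt_barrierCost δ (hQ.1.1 i).1 (hQ.1.1 i).2
    exact HasDerivAt.comp_of_eq (0 : ℝ) cost (line i) (by simp)
  have feasible : ∀ᶠ h : ℝ in 𝓝 0, (fun i => Q i + h * d i) ∈ dispatchSet gen D := by
    have box : ∀ᶠ h : ℝ in 𝓝 0, (fun i => Q i + h * d i) ∈ capacityBox gen :=
      (by fun_prop : Continuous fun (h : ℝ) i => Q i + h * d i).continuousAt.eventually_mem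
        ((isOpen_capacityBox gen).mem_nhds (by simpa only [zero_mul, add_zero] using! hQ.1.1))
    filter_upwards [box] with h hh
    exact ⟨hh, by rw [Finset.sum_add_distrib, ← Finset.mul_sum, hd, mul_zero, add_zero, hQ.1.2]⟩
  refine IsLocalMin.hasDerivAt_eq_zero ?_ deriv
  filter_upwards [feasible] with h hh
  simpa using hQ.totalCost_le hh

theorem incCost_eq (hQ : IsOptimalDispatch gen δ D Q) (i j : Fin N) :
    incCost gen δ Q i = incCost gen δ Q j := by
  have h := hQ.sum_incCost_mul_eq_zero (d := Pi.single i 1 - Pi.single j 1) (by simp)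
  simp only [Pi.sub_apply, mul_sub, Finset.sum_sub_distrib] at h
  simpa [Pi.single_apply, sub_eq_zero] using h

theorem sum_sub_eq_zero (hQ : IsOptimalDispatch gen δ D Q) (hP : P ∈ dispatchSet gen D) :
    ∑ i, (P i - Q i) = 0 := by
  rw [Finset.sum_sub_distrib, hP.2, hQ.1.2, sub_self]

theorem sum_mul_sq_sub_le (hδ : 0 ≤ δ) (hQ : IsOptimalDispatch gen δ D Q)
    (hP : P ∈ dispatchSet gen D) :
    ∑ i, (gen i).c * (P i - Q i) ^ 2 ≤ totalCost gen δ P - totalCost gen δ Q := by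
  calc ∑ i, (gen i).c * (P i - Q i) ^ 2
      = ∑ i, (incCost gen δ Q i * (P i - Q i) + (gen i).c * (P i - Q i) ^ 2) := by
        rw [Finset.sum_add_distrib, hQ.sum_incCost_mul_eq_zero (hQ.sum_sub_eq_zero hP), zero_add]
    _ ≤ ∑ i, ((gen i).barrierCost δ (P i) - (gen i).barrierCost δ (Q i)) :=
        Finset.sum_le_sum fun i _ =>
          Generator.incrementalCost_mul_add_le_barrierCost_sub hδ (hP.1 i) (hQ.1.1 i)
    _ = totalCost gen δ P - totalCost gen δ Q := Finset.sum_sub_distrib _ _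

theorem mul_sq_sub_le (hc : ∀ i, 0 ≤ (gen i).c) (hδ : 0 ≤ δ) (hQ : IsOptimalDispatch gen δ D Q)
    (hP : P ∈ dispatchSet gen D) (i : Fin N) :
    (gen i).c * (P i - Q i) ^ 2 ≤ totalCost gen δ P - totalCost gen δ Q :=
  (Finset.single_le_sum (f := fun i => (gen i).c * (P i - Q i) ^ 2)
    (fun i _ => mul_nonneg (hc i) (sq_nonneg _)) (Finset.mem_univ i)).trans
    (hQ.sum_mul_sq_sub_le hδ hP)

theorem eq_of_totalCost_le (hc : ∀ i, 0 < (gen i).c) (hδ : 0 ≤ δ)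
    (hQ : IsOptimalDispatch gen δ D Q) (hP : P ∈ dispatchSet gen D)
    (h : totalCost gen δ P ≤ totalCost gen δ Q) : P = Q := by
  funext i
  have hi := (hQ.mul_sq_sub_le (fun i => (hc i).le) hδ hP i).trans (sub_nonpos.2 h)
  have hsq : (P i - Q i) ^ 2 = 0 := (nonpos_of_mul_nonpos_right hi (hc i)).antisymm (sq_nonneg _)
  exact sub_eq_zero.1 (pow_eq_zero_iff two_ne_zero |>.1 hsq)

theorem unique (hc : ∀ i, 0 < (gen i).c) (hδ : 0 ≤ δ) (hQ : IsOptimalDispatch gen δ D Q)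
    (hP : IsOptimalDispatch gen δ D P) : P = Q :=
  hQ.eq_of_totalCost_le hc hδ hP.1 (hP.totalCost_le hQ.1)

end IsOptimalDispatch

theorem sum_consensusError (gen : Fin N → Generator) (δ : ℝ) (P : Fin N → ℝ) :
    ∑ i, consensusError gen δ P i = 0 := by
  have card_mul : (N : ℝ) * ((∑ j, incCost gen δ P j) / N) = ∑ j, incCost gen δ P j :=
    mul_div_cancel_of_imp' fun hN => by
      obtain rfl := Nat.cast_eq_zero.1 hN
      exact Finset.sum_empty
  simp only [consensusError, Finset.sum_sub_distrib, Finset.sum_const, Finset.card_univ,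
    Fintype.card_fin, nsmul_eq_mul, card_mul, sub_self]

theorem sum_consensusError_mul {d : Fin N → ℝ} (hd : ∑ i, d i = 0) :
    ∑ i, consensusError gen δ P i * d i = ∑ i, incCost gen δ P i * d i := by
  simp only [consensusError, sub_mul, Finset.sum_sub_distrib]
  rw [← Finset.mul_sum, hd, mul_zero, sub_zero]

theorem sum_consensusError_sq_le (x : ℝ) :
    ∑ i, consensusError gen δ P i ^ 2 ≤ ∑ i, (incCost gen δ P i - x) ^ 2 := by
  set y : ℝ := (∑ j, incCost gen δ P j) / N - x
  have split : ∀ i, (incCost gen δ P i - x) ^ 2 =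
      consensusError gen δ P i ^ 2 + 2 * y * consensusError gen δ P i + y ^ 2 := fun i => by
    simp only [consensusError, y]
    ring
  calc ∑ i, consensusError gen δ P i ^ 2
      ≤ ∑ i, consensusError gen δ P i ^ 2 + ∑ _i : Fin N, y ^ 2 :=
        le_add_of_nonneg_right (Finset.sum_nonneg fun _ _ => sq_nonneg _)
    _ = ∑ i, (incCost gen δ P i - x) ^ 2 := by
        simp only [split, Finset.sum_add_distrib, ← Finset.mul_sum, sum_consensusError, mul_zero,
          add_zero]

theorem IsOptimalDispatch.totalCost_sub_le (hδ : 0 ≤ δ) (hc₀ : 0 < c₀)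
    (hc : ∀ i, c₀ ≤ (gen i).c) (hQ : IsOptimalDispatch gen δ D Q) (hP : P ∈ dispatchSet gen D) :
    4 * c₀ * (totalCost gen δ P - totalCost gen δ Q) ≤ ∑ i, consensusError gen δ P i ^ 2 := by
  have convexity : totalCost gen δ P - totalCost gen δ Q ≤
      ∑ i, (consensusError gen δ P i * (P i - Q i) - c₀ * (P i - Q i) ^ 2) := by
    rw [Finset.sum_sub_distrib, sum_consensusError_mul (hQ.sum_sub_eq_zero hP),
      ← Finset.sum_sub_distrib, totalCost, totalCost, ← Finset.sum_sub_distrib]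
    refine Finset.sum_le_sum fun i _ => ?_
    have h := Generator.incrementalCost_mul_add_le_barrierCost_sub hδ (hQ.1.1 i) (hP.1 i)
    have h' := mul_le_mul_of_nonneg_right (hc i) (sq_nonneg (P i - Q i))
    unfold incCost
    linarith
  calc 4 * c₀ * (totalCost gen δ P - totalCost gen δ Q)
      ≤ ∑ i, 4 * c₀ * (consensusError gen δ P i * (P i - Q i) - c₀ * (P i - Q i) ^ 2) := by
        rw [← Finset.mul_sum]
        exact mul_le_mul_of_nonneg_left convexity (by positivity)
    _ ≤ ∑ i, consensusError gen δ P i ^ 2 := Finset.sum_le_sum fun i _ => by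
        linarith [sq_nonneg (consensusError gen δ P i - 2 * c₀ * (P i - Q i))]

theorem exists_sum_sq_incCost_sub_le (gen : Fin N → Generator) (δ : ℝ) {m : ℝ} (hm : 0 < m) :
    ∃ L, 0 < L ∧ ∀ P ∈ marginBox gen m, ∀ Q ∈ marginBox gen m,
      ∑ i, (incCost gen δ P i - incCost gen δ Q i) ^ 2 ≤ L * ∑ i, (P i - Q i) ^ 2 := by
  obtain ⟨Λ, hΛ⟩ := ((contDiffOn_incCost gen δ).mono
    (marginBox_subset_capacityBox hm)).exists_lipschitzOnWith one_ne_zero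
    (convex_Icc _ _) (isCompact_marginBox gen m)
  refine ⟨N * Λ ^ 2 + 1, by positivity, fun P hP Q hQ => ?_⟩
  have norm_sq_le : ‖P - Q‖ ^ 2 ≤ ∑ i, (P i - Q i) ^ 2 := by
    refine Real.le_sqrt (norm_nonneg _) (Finset.sum_nonneg fun _ _ => sq_nonneg _) |>.1 ?_
    refine (pi_norm_le_iff_of_nonneg (Real.sqrt_nonneg _)).2 fun i => Real.abs_le_sqrt ?_
    exact Finset.single_le_sum (f := fun i => (P i - Q i) ^ 2) (fun _ _ => sq_nonneg _)
      (Finset.mem_univ i)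
  have coordinate : ∀ i, (incCost gen δ P i - incCost gen δ Q i) ^ 2 ≤ Λ ^ 2 * ‖P - Q‖ ^ 2 :=
    fun i => by
      rw [← mul_pow]
      exact sq_le_sq.2 <| ((norm_le_pi_norm (incCost gen δ P - incCost gen δ Q) i).trans
        (hΛ.norm_sub_le hP hQ)).trans (le_abs_self _)
  calc ∑ i, (incCost gen δ P i - incCost gen δ Q i) ^ 2
      ≤ ∑ _i : Fin N, (Λ : ℝ) ^ 2 * ‖P - Q‖ ^ 2 := Finset.sum_le_sum fun i _ => coordinate i
    _ = N * Λ ^ 2 * ‖P - Q‖ ^ 2 := by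
        rw [Finset.sum_const, Finset.card_univ, Fintype.card_fin, nsmul_eq_mul, mul_assoc]
    _ ≤ (N * Λ ^ 2 + 1) * ∑ i, (P i - Q i) ^ 2 := by
        gcongr
        exact le_add_of_nonneg_right zero_le_one

theorem IsOptimalDispatch.exists_sum_consensusError_sq_le (hδ : 0 ≤ δ) (hc₀ : 0 < c₀)
    (hc : ∀ i, c₀ ≤ (gen i).c) (hQ : IsOptimalDispatch gen δ D Q) {m : ℝ} (hm : 0 < m)
    (hQm : Q ∈ marginBox gen m) :
    ∃ B, 0 < B ∧ ∀ P ∈ dispatchSet gen D, P ∈ marginBox gen m →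
      ∑ i, consensusError gen δ P i ^ 2 ≤ B * (totalCost gen δ P - totalCost gen δ Q) := by
  obtain ⟨L, hL, hlip⟩ := exists_sum_sq_incCost_sub_le gen δ hm
  refine ⟨L / c₀, by positivity, fun P hP hPm => ?_⟩
  have to_optimum : ∑ i, consensusError gen δ P i ^ 2 ≤
      ∑ i, (incCost gen δ P i - incCost gen δ Q i) ^ 2 := by
    rcases isEmpty_or_nonempty (Fin N) with _ | ⟨⟨k⟩⟩
    · simp
    · simpa only [hQ.incCost_eq _ k] using sum_consensusError_sq_le (incCost gen δ Q k)
  have growth : c₀ * ∑ i, (P i - Q i) ^ 2 ≤ totalCost gen δ P - totalCost gen δ Q := by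
    rw [Finset.mul_sum]
    exact (Finset.sum_le_sum fun i _ => mul_le_mul_of_nonneg_right (hc i) (sq_nonneg _)).trans
      (hQ.sum_mul_sq_sub_le hδ hP)
  calc ∑ i, consensusError gen δ P i ^ 2 ≤ L * ∑ i, (P i - Q i) ^ 2 :=
        to_optimum.trans (hlip P hPm Q hQm)
    _ = L / c₀ * (c₀ * ∑ i, (P i - Q i) ^ 2) := by field_simp
    _ ≤ L / c₀ * (totalCost gen δ P - totalCost gen δ Q) := by gcongr

theorem IsOptimalDispatch.exists_sum_consensusError_sq_le_of_totalCost_le (hδ : 0 < δ)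
    (hc₀ : 0 < c₀) (hc : ∀ i, c₀ ≤ (gen i).c) (hQ : IsOptimalDispatch gen δ D Q) (E : ℝ) :
    ∃ B, 0 < B ∧ ∀ P ∈ dispatchSet gen D, totalCost gen δ P ≤ E →
      ∑ i, consensusError gen δ P i ^ 2 ≤ B * (totalCost gen δ P - totalCost gen δ Q) := by
  obtain ⟨m, hm, margin⟩ := exists_marginBox_of_totalCost_le (fun i => hc₀.trans_le (hc i)) hδ
    (max E (totalCost gen δ Q))
  obtain ⟨B, hB, error_le⟩ := hQ.exists_sum_consensusError_sq_le hδ.le hc₀ hc hm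
    (margin Q hQ.1.1 (le_max_right _ _))
  exact ⟨B, hB, fun P hP hE => error_le P hP (margin P hP.1 (hE.trans (le_max_left _ _)))⟩

end Dispatch

section Energy

variable {N M : ℕ} {gen : Fin N → Generator} {δ D γ : ℝ} {β : Fin N → Fin N → ℝ}
  {G : Fin M → SimpleGraph (Fin N)} {θ A : Fin N → Fin N → ℝ} {P Q : Fin N → ℝ}

open Classical in
/-- The part of `energy` that measures the deviation of the weights `A` from the target weights
`θ`, without the scaling factor `γ`. -/
noncomputable def adaptationEnergy (β : Fin N → Fin N → ℝ) (G : Fin M → SimpleGraph (Fin N))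
    (θ A : Fin N → Fin N → ℝ) : ℝ :=
  ∑ i, ∑ j, if ∃ k, (G k).Adj i j then (θ i j - A i j) ^ 2 / (4 * β i j) else 0

theorem energy_eq (gen : Fin N → Generator) (δ : ℝ) (β : Fin N → Fin N → ℝ)
    (G : Fin M → SimpleGraph (Fin N)) (γ : ℝ) (θ : Fin N → Fin N → ℝ) (Q P : Fin N → ℝ)
    (A : Fin N → Fin N → ℝ) :
    energy gen δ β G γ θ Q P A =
      γ * (totalCost gen δ P - totalCost gen δ Q + adaptationEnergy β G θ A) := by
  simp only [energy, adaptationEnergy, totalCost, mul_add, Finset.sum_sub_distrib, Finset.mul_sum,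
    mul_ite, mul_zero, mul_div_assoc', div_mul_eq_mul_div]

theorem adaptationEnergy_nonneg (hβ : ∀ i j, 0 < β i j) (θ A : Fin N → Fin N → ℝ) :
    0 ≤ adaptationEnergy β G θ A := by
  classical
  refine Finset.sum_nonneg fun i _ => Finset.sum_nonneg fun j _ => ?_
  have := hβ i j
  split_ifs <;> positivity

theorem adaptationEnergy_self (θ : Fin N → Fin N → ℝ) : adaptationEnergy β G θ θ = 0 := by
  simp [adaptationEnergy]

theorem sq_sub_le_adaptationEnergy (hβ : ∀ i j, 0 < β i j) (θ A : Fin N → Fin N → ℝ)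
    {k : Fin M} {i j : Fin N} (hij : (G k).Adj i j) :
    (θ i j - A i j) ^ 2 ≤ 4 * β i j * adaptationEnergy β G θ A := by
  classical
  set F : Fin N → Fin N → ℝ := fun i j =>
    if ∃ k, (G k).Adj i j then (θ i j - A i j) ^ 2 / (4 * β i j) else 0
  have nonneg : ∀ i j, 0 ≤ F i j := fun i j => by
    have := hβ i j
    simp only [F]
    split_ifs <;> positivity
  have single : F i j ≤ adaptationEnergy β G θ A :=
    (Finset.single_le_sum (fun j _ => nonneg i j) (Finset.mem_univ j)).trans
      (Finset.single_le_sum (f := fun i => ∑ j, F i j)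
        (fun i _ => Finset.sum_nonneg fun j _ => nonneg i j) (Finset.mem_univ i))
  have hβij := hβ i j
  rwa [show F i j = (θ i j - A i j) ^ 2 / (4 * β i j) from if_pos ⟨k, hij⟩,
    div_le_iff₀' (by positivity)] at single

theorem adaptationEnergy_eq_zero_iff (hβ : ∀ i j, 0 < β i j) :
    adaptationEnergy β G θ A = 0 ↔ ∀ k i j, (G k).Adj i j → A i j = θ i j := by
  constructor
  · intro h k i j hij
    have hsq := sq_sub_le_adaptationEnergy hβ θ A hij
    rw [h, mul_zero] at hsq
    exact (sub_eq_zero.1 (pow_eq_zero_iff two_ne_zero |>.1 (hsq.antisymm (sq_nonneg _)))).symm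
  · intro h
    refine Finset.sum_eq_zero fun i _ => Finset.sum_eq_zero fun j _ => ?_
    split_ifs with hij
    · obtain ⟨k, hk⟩ := hij
      rw [h k i j hk, sub_self, zero_pow two_ne_zero, zero_div]
    · rfl

theorem IsOptimalDispatch.energy_nonneg (hβ : ∀ i j, 0 < β i j)
    (hQ : IsOptimalDispatch gen δ D Q) (hγ : 0 ≤ γ) (hP : P ∈ dispatchSet gen D)
    (θ A : Fin N → Fin N → ℝ) : 0 ≤ energy gen δ β G γ θ Q P A := by
  rw [energy_eq]
  exact mul_nonneg hγ
    (add_nonneg (sub_nonneg.2 (hQ.totalCost_le hP)) (adaptationEnergy_nonneg hβ θ A))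

theorem IsOptimalDispatch.energy_eq_zero_iff (hc : ∀ i, 0 < (gen i).c) (hδ : 0 ≤ δ)
    (hβ : ∀ i j, 0 < β i j) (hQ : IsOptimalDispatch gen δ D Q) (hγ : 0 < γ)
    (hP : P ∈ dispatchSet gen D) : energy gen δ β G γ θ Q P A = 0 ↔
      P = Q ∧ ∀ k i j, (G k).Adj i j → A i j = θ i j := by
  have cost := sub_nonneg.2 (hQ.totalCost_le hP)
  rw [energy_eq, mul_eq_zero_iff_left hγ.ne',
    add_eq_zero_iff_of_nonneg cost (adaptationEnergy_nonneg hβ θ A),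
    adaptationEnergy_eq_zero_iff hβ]
  refine and_congr_left' ⟨fun h => hQ.eq_of_totalCost_le hc hδ hP (sub_nonpos.1 h.le), ?_⟩
  rintro rfl
  exact sub_self _

theorem continuousOn_energy (gen : Fin N → Generator) (δ : ℝ) (β : Fin N → Fin N → ℝ)
    (G : Fin M → SimpleGraph (Fin N)) (γ : ℝ) (θ : Fin N → Fin N → ℝ) (Q : Fin N → ℝ) :
    ContinuousOn (fun x : (Fin N → ℝ) × (Fin N → Fin N → ℝ) => energy gen δ β G γ θ Q x.1 x.2)
      (Prod.fst ⁻¹' capacityBox gen) := by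
  have cost := (continuousOn_totalCost gen δ).comp continuousOn_fst
    (mapsTo_preimage (Prod.fst (β := Fin N → Fin N → ℝ)) (capacityBox gen))
  have adaptation : Continuous (adaptationEnergy β G θ) :=
    continuous_finsetSum _ fun i _ => continuous_finsetSum _ fun j _ => by
      split_ifs <;> fun_prop
  simp only [energy_eq]
  exact continuousOn_const.mul ((cost.sub continuousOn_const).add
    (adaptation.comp continuous_snd).continuousOn)

end Energy

section Protocol

variable {N M : ℕ} {gen : Fin N → Generator} {δ D γ c₀ α r T : ℝ} {β : Fin N → Fin N → ℝ}
  {G : Fin M → SimpleGraph (Fin N)} {s : ℝ → Fin M} {θ : Fin N → Fin N → ℝ} {Q : Fin N → ℝ}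

/-- A state of the protocol: the generated powers and the coupling weights. -/
abbrev ProtocolState (N : ℕ) : Type := (Fin N → ℝ) × (Fin N → Fin N → ℝ)

variable {x : ℝ → ProtocolState N}

open Classical in
/-- The vector field of the adaptive protocol on the communication graph `H`. -/
noncomputable def protocolField (gen : Fin N → Generator) (δ : ℝ) (β : Fin N → Fin N → ℝ)
    (H : SimpleGraph (Fin N)) (x : ProtocolState N) : ProtocolState N :=
  (coupling H x.2 (incCost gen δ x.1), fun i j =>
    if H.Adj i j then β i j * (incCost gen δ x.1 i - incCost gen δ x.1 j) ^ 2 else 0)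

/-- The states on which the protocol is defined: those whose powers lie strictly within the
capacity limits. -/
def stateDomain (gen : Fin N → Generator) : Set (ProtocolState N) :=
  Prod.fst ⁻¹' capacityBox gen

/-- The states that are admissible as initial data. -/
def IsAdmissibleState (gen : Fin N → Generator) (D : ℝ) (G : Fin M → SimpleGraph (Fin N))
    (x : ProtocolState N) : Prop :=
  x.1 ∈ dispatchSet gen D ∧ AdmissibleWeights G x.2

/-- `x` solves the switched protocol on `[0, T]` without leaving the capacity limits. -/
def IsTrajectory (gen : Fin N → Generator) (δ : ℝ) (β : Fin N → Fin N → ℝ)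
    (G : Fin M → SimpleGraph (Fin N)) (s : ℝ → Fin M) (T : ℝ) (x : ℝ → ProtocolState N) : Prop :=
  IsSwitchedSolution (fun k => protocolField gen δ β (G k)) s (stateDomain gen) T x

theorem isOpen_stateDomain (gen : Fin N → Generator) : IsOpen (stateDomain gen) :=
  (isOpen_capacityBox gen).preimage continuous_fst

theorem contDiffOn_protocolField (gen : Fin N → Generator) (δ : ℝ) (β : Fin N → Fin N → ℝ)
    (H : SimpleGraph (Fin N)) : ContDiffOn ℝ 1 (protocolField gen δ β H) (stateDomain gen) := by
  have weight : ∀ i j, ContDiffOn ℝ 1 (fun x : ProtocolState N => x.2 i j) (stateDomain gen) :=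
    fun i j => by fun_prop
  have cost : ∀ i, ContDiffOn ℝ 1 (fun x : ProtocolState N => incCost gen δ x.1 i)
      (stateDomain gen) := fun i =>
    (contDiffOn_pi.1 (contDiffOn_incCost gen δ) i).comp contDiff_fst.contDiffOn fun _ hx => hx
  refine ContDiffOn.prodMk (contDiffOn_pi.2 fun i => ContDiffOn.sum fun j _ => ?_)
    (contDiffOn_pi.2 fun i => contDiffOn_pi.2 fun j => ?_)
  · split_ifs
    · exact (weight i j).mul ((cost j).sub (cost i))
    · exact contDiffOn_const
  · split_ifs
    · exact contDiffOn_const.mul (((cost i).sub (cost j)).pow 2)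
    · exact contDiffOn_const

theorem isTrajectory_of_isProtocolSolution {P : ℝ → Fin N → ℝ} {A : ℝ → Fin N → Fin N → ℝ}
    (h : IsProtocolSolution gen δ β G s P A) (hmem : ∀ t ∈ Icc 0 T, P t ∈ capacityBox gen) :
    IsTrajectory gen δ β G s T fun t => (P t, A t) where
  continuousOn :=
    (continuousOn_pi.2 fun i => (h.continuousOn_power i).mono Icc_subset_Ici_self).prodMk
      (continuousOn_pi.2 fun i => continuousOn_pi.2 fun j =>
        (h.continuousOn_weight i j).mono Icc_subset_Ici_self)
  hasDerivWithinAt t ht :=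
    (hasDerivWithinAt_pi.2 (h.power_deriv t ht.1)).prodMk
      (hasDerivWithinAt_pi.2 fun i => hasDerivWithinAt_pi.2 (h.weight_deriv t ht.1 i))
  mem := hmem

namespace IsTrajectory

theorem mono {T' : ℝ} (h : IsTrajectory gen δ β G s T x) (hT : T' ≤ T) :
    IsTrajectory gen δ β G s T' x :=
  IsSwitchedSolution.mono h hT

theorem continuousOn_power (h : IsTrajectory gen δ β G s T x) :
    ContinuousOn (fun t => (x t).1) (Icc 0 T) :=
  h.continuousOn.fst

theorem continuousOn_weight (h : IsTrajectory gen δ β G s T x) (i j : Fin N) :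
    ContinuousOn (fun t => (x t).2 i j) (Icc 0 T) :=
  continuousOn_pi.1 (continuousOn_pi.1 h.continuousOn.snd i) j

theorem hasDerivWithinAt_power (h : IsTrajectory gen δ β G s T x) {t : ℝ} (ht : t ∈ Ico 0 T)
    (i : Fin N) : HasDerivWithinAt (fun t => (x t).1 i)
      (coupling (G (s t)) (x t).2 (incCost gen δ (x t).1) i) (Ici t) t :=
  hasDerivWithinAt_pi.1 (h.hasDerivWithinAt t ht).fst i

open Classical in
theorem hasDerivWithinAt_weight (h : IsTrajectory gen δ β G s T x) {t : ℝ} (ht : t ∈ Ico 0 T)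
    (i j : Fin N) : HasDerivWithinAt (fun t => (x t).2 i j)
      (if (G (s t)).Adj i j then
        β i j * (incCost gen δ (x t).1 i - incCost gen δ (x t).1 j) ^ 2 else 0) (Ici t) t :=
  hasDerivWithinAt_pi.1 (hasDerivWithinAt_pi.1 (h.hasDerivWithinAt t ht).snd i) j

theorem weight_symm (h : IsTrajectory gen δ β G s T x) (hT : 0 ≤ T)
    (hβ : ∀ i j, β i j = β j i) (h₀ : ∀ i j, (x 0).2 i j = (x 0).2 j i) (i j : Fin N) :
    (x T).2 i j = (x T).2 j i := by
  classical
  have deriv : ∀ t ∈ Ico 0 T,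
      HasDerivWithinAt (fun t => (x t).2 i j - (x t).2 j i) 0 (Ici t) t := fun t ht => by
    refine ((h.hasDerivWithinAt_weight ht i j).sub
      (h.hasDerivWithinAt_weight ht j i)).congr_deriv ?_
    exact sub_eq_zero.2 (if_congr ((G (s t)).adj_comm i j) (by rw [hβ i j, sub_sq_comm]) rfl)
  have const := constant_of_has_deriv_right_zero
    ((h.continuousOn_weight i j).sub (h.continuousOn_weight j i)) deriv T (right_mem_Icc.2 hT)
  exact sub_eq_zero.1 (const.trans (sub_eq_zero.2 (h₀ i j)))

theorem monotoneOn_weight (h : IsTrajectory gen δ β G s T x) (hβ : ∀ i j, 0 ≤ β i j)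
    (i j : Fin N) : MonotoneOn (fun t => (x t).2 i j) (Icc 0 T) := by
  classical
  intro a ha b hb hab
  refine neg_le_neg_iff.1 (le_of_right_deriv_nonpos (f := fun t => -(x t).2 i j) hab
    ((h.continuousOn_weight i j).neg.mono (Icc_subset_Icc ha.1 hb.2))
    (fun t ht => (h.hasDerivWithinAt_weight ⟨ha.1.trans ht.1, ht.2.trans_le hb.2⟩ i j).neg)
    fun t _ => neg_nonpos.2 ?_)
  split_ifs
  · exact mul_nonneg (hβ i j) (sq_nonneg _)
  · exact le_rfl

theorem weight_eq_of_forall_not_adj (h : IsTrajectory gen δ β G s T x) (hT : 0 ≤ T)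
    {i j : Fin N} (hij : ∀ k, ¬(G k).Adj i j) : (x T).2 i j = (x 0).2 i j := by
  classical
  exact constant_of_has_deriv_right_zero (h.continuousOn_weight i j)
    (fun t ht => by simpa only [if_neg (hij _)] using h.hasDerivWithinAt_weight ht i j)
    T (right_mem_Icc.2 hT)

theorem sum_power_eq (h : IsTrajectory gen δ β G s T x) (hT : 0 ≤ T)
    (hβ : ∀ i j, β i j = β j i) (h₀ : ∀ i j, (x 0).2 i j = (x 0).2 j i) :
    ∑ i, (x T).1 i = ∑ i, (x 0).1 i := by
  refine constant_of_has_deriv_right_zero (f := fun t => ∑ i, (x t).1 i)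
    (continuousOn_finsetSum _ fun i _ => continuousOn_pi.1 h.continuousOn_power i)
    (fun t ht => ?_) T (right_mem_Icc.2 hT)
  exact (HasDerivWithinAt.fun_sum fun i _ => h.hasDerivWithinAt_power ht i).congr_deriv
    (sum_coupling ((h.mono ht.2.le).weight_symm ht.1 hβ h₀))

theorem isAdmissibleState (h : IsTrajectory gen δ β G s T x) (hT : 0 ≤ T)
    (hβ : ∀ i j, 0 < β i j) (hβ_symm : ∀ i j, β i j = β j i)
    (h₀ : IsAdmissibleState gen D G (x 0)) : IsAdmissibleState gen D G (x T) :=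
  ⟨⟨h.mem T (right_mem_Icc.2 hT), (h.sum_power_eq hT hβ_symm h₀.2.1).trans h₀.1.2⟩,
    h.weight_symm hT hβ_symm h₀.2.1, fun k i j hij => (h₀.2.2 k i j hij).trans_le
      (h.monotoneOn_weight (fun i j => (hβ i j).le) i j (left_mem_Icc.2 hT) (right_mem_Icc.2 hT)
        hT)⟩

theorem continuousOn_totalCost (h : IsTrajectory gen δ β G s T x) :
    ContinuousOn (fun t => totalCost gen δ (x t).1) (Icc 0 T) :=
  (_root_.continuousOn_totalCost gen δ).comp h.continuousOn_power h.mem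

theorem hasDerivWithinAt_totalCost (h : IsTrajectory gen δ β G s T x)
    (hβ : ∀ i j, β i j = β j i) (h₀ : ∀ i j, (x 0).2 i j = (x 0).2 j i) {t : ℝ}
    (ht : t ∈ Ico 0 T) : HasDerivWithinAt (fun t => totalCost gen δ (x t).1)
      (-dirichletForm (G (s t)) (x t).2 (incCost gen δ (x t).1)) (Ici t) t := by
  refine (HasDerivWithinAt.fun_sum fun i _ => ?_).congr_deriv
    (sum_mul_coupling ((h.mono ht.2.le).weight_symm ht.1 hβ h₀))
  have limits := h.mem t (Ico_subset_Icc_self ht) i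
  exact ((gen i).hasDerivAt_barrierCost δ limits.1 limits.2).comp_hasDerivWithinAt t
    (h.hasDerivWithinAt_power ht i)

theorem hasDerivWithinAt_adaptationEnergy (h : IsTrajectory gen δ β G s T x)
    (hβ : ∀ i j, 0 < β i j) (θ : Fin N → Fin N → ℝ) {t : ℝ} (ht : t ∈ Ico 0 T) :
    HasDerivWithinAt (fun t => adaptationEnergy β G θ (x t).2)
      (-dirichletForm (G (s t)) (θ - (x t).2) (incCost gen δ (x t).1)) (Ici t) t := by
  classical
  rw [dirichletForm, Finset.mul_sum, ← Finset.sum_neg_distrib]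
  refine HasDerivWithinAt.fun_sum fun i _ => ?_
  rw [Finset.mul_sum, ← Finset.sum_neg_distrib]
  refine HasDerivWithinAt.fun_sum fun j _ => ?_
  have hβij := (hβ i j).ne'
  by_cases hij : ∃ k, (G k).Adj i j
  · simp only [if_pos hij]
    refine (((h.hasDerivWithinAt_weight ht i j).const_sub (θ i j)).fun_pow 2
      |>.div_const (4 * β i j)).congr_deriv ?_
    simp only [Pi.sub_apply]
    split_ifs
    · field_simp
      ring
    · simp
  · have hij' : ¬(G (s t)).Adj i j := fun h => hij ⟨_, h⟩
    simpa only [if_neg hij, if_neg hij', mul_zero, neg_zero] using hasDerivWithinAt_const _ _ _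

/-- The weight-dependent parts of the two derivatives cancel, which is why only the constant
target weights `θ` appear. -/
theorem hasDerivWithinAt_energy (h : IsTrajectory gen δ β G s T x) (hβ : ∀ i j, 0 < β i j)
    (hβ_symm : ∀ i j, β i j = β j i) (h₀ : ∀ i j, (x 0).2 i j = (x 0).2 j i) (γ : ℝ)
    (θ : Fin N → Fin N → ℝ) (Q : Fin N → ℝ) {t : ℝ} (ht : t ∈ Ico 0 T) :
    HasDerivWithinAt (fun t => energy gen δ β G γ θ Q (x t).1 (x t).2)
      (-γ * dirichletForm (G (s t)) θ (incCost gen δ (x t).1)) (Ici t) t := by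
  simp only [energy_eq]
  refine (((h.hasDerivWithinAt_totalCost hβ_symm h₀ ht).sub_const _).add
    (h.hasDerivWithinAt_adaptationEnergy hβ θ ht) |>.const_mul γ).congr_deriv ?_
  rw [dirichletForm_sub]
  ring

theorem totalCost_le (h : IsTrajectory gen δ β G s T x) (hT : 0 ≤ T) (hβ : ∀ i j, 0 < β i j)
    (hβ_symm : ∀ i j, β i j = β j i) (h₀ : IsAdmissibleState gen D G (x 0)) :
    totalCost gen δ (x T).1 ≤ totalCost gen δ (x 0).1 :=
  le_of_right_deriv_nonpos hT h.continuousOn_totalCost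
    (fun _ => h.hasDerivWithinAt_totalCost hβ_symm h₀.2.1) fun _ ht =>
      neg_nonpos.2 <| dirichletForm_nonneg fun i j hij =>
        (((h.mono ht.2.le).isAdmissibleState ht.1 hβ hβ_symm h₀).2.2 _ i j hij).le

theorem energy_le (h : IsTrajectory gen δ β G s T x) (hT : 0 ≤ T) (hβ : ∀ i j, 0 < β i j)
    (hβ_symm : ∀ i j, β i j = β j i) (h₀ : ∀ i j, (x 0).2 i j = (x 0).2 j i) (hγ : 0 ≤ γ)
    (hθ : ∀ k i j, (G k).Adj i j → 0 ≤ θ i j) (Q : Fin N → ℝ) :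
    energy gen δ β G γ θ Q (x T).1 (x T).2 ≤ energy gen δ β G γ θ Q (x 0).1 (x 0).2 :=
  le_of_right_deriv_nonpos (f := fun t => energy gen δ β G γ θ Q (x t).1 (x t).2) hT
    ((continuousOn_energy gen δ β G γ θ Q).comp h.continuousOn h.mem)
    (fun _ => h.hasDerivWithinAt_energy hβ hβ_symm h₀ γ θ Q) fun t _ =>
      mul_nonpos_of_nonpos_of_nonneg (neg_nonpos.2 hγ) (dirichletForm_nonneg (hθ (s t)))

/-- The energy with the initial weights as targets controls how far the weights can drift. -/
theorem sq_weight_sub_le (h : IsTrajectory gen δ β G s T x) (hT : 0 ≤ T)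
    (hβ : ∀ i j, 0 < β i j) (hβ_symm : ∀ i j, β i j = β j i) (hQ : IsOptimalDispatch gen δ D Q)
    (h₀ : IsAdmissibleState gen D G (x 0)) (i j : Fin N) :
    ((x 0).2 i j - (x T).2 i j) ^ 2 ≤
      4 * β i j * (totalCost gen δ (x 0).1 - totalCost gen δ Q) := by
  have hβij := hβ i j
  have excess_nonneg := sub_nonneg.2 (hQ.totalCost_le h₀.1)
  by_cases hij : ∃ k, (G k).Adj i j
  · obtain ⟨k, hk⟩ := hij
    have energy_le := h.energy_le hT hβ hβ_symm h₀.2.1 (γ := 1) zero_le_one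
      (fun k i j hij => (h₀.2.2 k i j hij).le) Q
    rw [energy_eq, energy_eq, adaptationEnergy_self, one_mul, one_mul, add_zero] at energy_le
    have excess_nonneg' := sub_nonneg.2
      (hQ.totalCost_le (h.isAdmissibleState hT hβ hβ_symm h₀).1)
    exact (sq_sub_le_adaptationEnergy hβ (x 0).2 (x T).2 hk).trans
      (mul_le_mul_of_nonneg_left (by linarith) (by positivity))
  · push Not at hij
    rw [h.weight_eq_of_forall_not_adj hT hij, sub_self, zero_pow two_ne_zero]
    positivity

end IsTrajectory

theorem exists_isCompact_forall_mem (hc : ∀ i, 0 < (gen i).c) (hδ : 0 < δ)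
    (hβ : ∀ i j, 0 < β i j) (hβ_symm : ∀ i j, β i j = β j i) (hQ : IsOptimalDispatch gen δ D Q)
    {x₀ : ProtocolState N} (hx₀ : IsAdmissibleState gen D G x₀) :
    ∃ K ⊆ stateDomain gen, IsCompact K ∧ ∀ s T x, 0 ≤ T → IsTrajectory gen δ β G s T x →
      x 0 = x₀ → x T ∈ K := by
  obtain ⟨m, hm, hbox⟩ := exists_marginBox_of_totalCost_le hc hδ (totalCost gen δ x₀.1)
  set R : Fin N → Fin N → ℝ := fun i j =>
    √(4 * β i j * (totalCost gen δ x₀.1 - totalCost gen δ Q))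
  refine ⟨marginBox gen m ×ˢ Icc (x₀.2 - R) (x₀.2 + R),
    fun x hx => marginBox_subset_capacityBox hm hx.1,
    (isCompact_marginBox gen m).prod isCompact_Icc, fun s T x hT h hx => ?_⟩
  subst hx
  have drift : ∀ i j, |(x 0).2 i j - (x T).2 i j| ≤ R i j := fun i j =>
    Real.abs_le_sqrt (h.sq_weight_sub_le hT hβ hβ_symm hQ hx₀ i j)
  exact ⟨hbox _ (h.mem T (right_mem_Icc.2 hT)) (h.totalCost_le hT hβ hβ_symm hx₀),
    fun i j => sub_le_comm.1 (abs_le.1 (drift i j)).2,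
    fun i j => neg_le_sub_iff_le_add.1 (abs_le.1 (drift i j)).1⟩

theorem IsProtocolSolution.isTrajectory {P : ℝ → Fin N → ℝ} {A : ℝ → Fin N → Fin N → ℝ}
    (h : IsProtocolSolution gen δ β G s P A) (hc : ∀ i, 0 < (gen i).c) (hδ : 0 < δ)
    (hβ : ∀ i j, 0 < β i j) (hβ_symm : ∀ i j, β i j = β j i) (hQ : IsOptimalDispatch gen δ D Q)
    (h₀ : IsAdmissibleState gen D G (P 0, A 0)) (T : ℝ) :
    IsTrajectory gen δ β G s T fun t => (P t, A t) := by
  obtain ⟨K, hKU, hK, hmem⟩ := exists_isCompact_forall_mem hc hδ hβ hβ_symm hQ h₀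
  have stays := mem_of_forward_invariant (f := fun t => (P t, A t))
    ((continuousOn_pi.2 h.continuousOn_power).prodMk
      (continuousOn_pi.2 fun i => continuousOn_pi.2 fun j => h.continuousOn_weight i j))
    (isOpen_stateDomain gen) hK.isClosed hKU h₀.1.1 fun T hT hU =>
      hmem s T _ hT (isTrajectory_of_isProtocolSolution h hU) rfl
  exact isTrajectory_of_isProtocolSolution h fun t ht => hKU (stays t ht.1)

theorem exists_isProtocolSolution (hc : ∀ i, 0 < (gen i).c) (hδ : 0 < δ)
    (hβ : ∀ i j, 0 < β i j) (hβ_symm : ∀ i j, β i j = β j i) (hQ : IsOptimalDispatch gen δ D Q)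
    (hs : IsSwitchingSignal s) {x₀ : ProtocolState N} (hx₀ : IsAdmissibleState gen D G x₀) :
    ∃ P A, IsProtocolSolution gen δ β G s P A ∧ P 0 = x₀.1 ∧ A 0 = x₀.2 := by
  obtain ⟨K, hKU, hK, hmem⟩ := exists_isCompact_forall_mem hc hδ hβ hβ_symm hQ hx₀
  obtain ⟨x, rfl, hcont, hderiv, -⟩ := exists_global_isSwitchedSolution (isOpen_stateDomain gen)
    (fun k => contDiffOn_protocolField gen δ β (G k)) hK hKU hx₀.1.1 (hmem s) hs.1 hs.2
  refine ⟨fun t => (x t).1, fun t => (x t).2, ⟨?_, ?_, ?_, ?_⟩, rfl, rfl⟩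
  · exact continuousOn_pi.1 hcont.fst
  · exact fun i => continuousOn_pi.1 (continuousOn_pi.1 hcont.snd i)
  · exact fun t ht => hasDerivWithinAt_pi.1 (hderiv t ht).fst
  · exact fun t ht i => hasDerivWithinAt_pi.1 (hasDerivWithinAt_pi.1 (hderiv t ht).snd i)

theorem IsProtocolSolution.unique {P P' : ℝ → Fin N → ℝ} {A A' : ℝ → Fin N → Fin N → ℝ}
    (h : IsProtocolSolution gen δ β G s P A) (h' : IsProtocolSolution gen δ β G s P' A')
    (hc : ∀ i, 0 < (gen i).c) (hδ : 0 < δ) (hβ : ∀ i j, 0 < β i j)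
    (hβ_symm : ∀ i j, β i j = β j i) (hQ : IsOptimalDispatch gen δ D Q)
    (h₀ : IsAdmissibleState gen D G (P 0, A 0)) (hP : P' 0 = P 0) (hA : A' 0 = A 0) {t : ℝ}
    (ht : 0 ≤ t) : P' t = P t ∧ A' t = A t :=
  Prod.ext_iff.1 <| IsSwitchedSolution.eqOn (isOpen_stateDomain gen)
    (fun k => contDiffOn_protocolField gen δ β (G k))
    (h'.isTrajectory hc hδ hβ hβ_symm hQ (by rwa [hP, hA]) t)
    (h.isTrajectory hc hδ hβ hβ_symm hQ h₀ t) (Prod.ext hP hA) (right_mem_Icc.2 ht)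

theorem IsOptimalDispatch.mul_totalCost_sub_le_dirichletForm {H : SimpleGraph (Fin N)}
    {A : Fin N → Fin N → ℝ} {P : Fin N → ℝ} (hδ : 0 ≤ δ) (hc₀ : 0 < c₀)
    (hc : ∀ i, c₀ ≤ (gen i).c) (hQ : IsOptimalDispatch gen δ D Q) (hP : P ∈ dispatchSet gen D)
    (hH : H.Connected) (hα : 0 ≤ α) (hA : ∀ i j, H.Adj i j → α ≤ A i j) :
    8 * c₀ * α * (totalCost gen δ P - totalCost gen δ Q) ≤
      N ^ 3 * dirichletForm H A (incCost gen δ P) := by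
  have poincare : 2 * ∑ i, consensusError gen δ P i ^ 2 ≤
      N ^ 3 * dirichletForm H (fun _ _ => 1) (incCost gen δ P) := by
    have h := two_mul_sum_sq_le_card_pow_three_mul_dirichletForm hH (sum_consensusError gen δ P)
    rw [Fintype.card_fin] at h
    exact h.trans_eq (congrArg _ (dirichletForm_sub_const _))
  calc 8 * c₀ * α * (totalCost gen δ P - totalCost gen δ Q)
      = α * (2 * (4 * c₀ * (totalCost gen δ P - totalCost gen δ Q))) := by ring
    _ ≤ α * (N ^ 3 * dirichletForm H (fun _ _ => 1) (incCost gen δ P)) := by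
        refine mul_le_mul_of_nonneg_left ?_ hα
        linarith [hQ.totalCost_sub_le hδ hc₀ hc hP]
    _ = N ^ 3 * (α * dirichletForm H (fun _ _ => 1) (incCost gen δ P)) := by ring
    _ ≤ N ^ 3 * dirichletForm H A (incCost gen δ P) := by
        gcongr
        exact mul_dirichletForm_one_le hA

theorem IsTrajectory.totalCost_sub_le_mul_exp (h : IsTrajectory gen δ β G s T x) (hT : 0 ≤ T)
    (hδ : 0 ≤ δ) (hc₀ : 0 < c₀) (hc : ∀ i, c₀ ≤ (gen i).c) (hβ : ∀ i j, 0 < β i j)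
    (hβ_symm : ∀ i j, β i j = β j i) (hG : ∀ k, (G k).Connected)
    (hQ : IsOptimalDispatch gen δ D Q) (h₀ : IsAdmissibleState gen D G (x 0)) (hα : 0 ≤ α)
    (hα₀ : ∀ k i j, (G k).Adj i j → α ≤ (x 0).2 i j) (hr : N ^ 3 * r ≤ 8 * c₀ * α) :
    totalCost gen δ (x T).1 - totalCost gen δ Q ≤
      (totalCost gen δ (x 0).1 - totalCost gen δ Q) * Real.exp (-r * T) := by
  refine exp_decay_of_right_deriv_le (f := fun t => totalCost gen δ (x t).1 - totalCost gen δ Q)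
    hT (h.continuousOn_totalCost.sub continuousOn_const)
    (fun t ht => (h.hasDerivWithinAt_totalCost hβ_symm h₀.2.1 ht).sub_const _) fun t ht => ?_
  have admissible := (h.mono ht.2.le).isAdmissibleState ht.1 hβ hβ_symm h₀
  have dissipation := hQ.mul_totalCost_sub_le_dirichletForm hδ hc₀ hc admissible.1 (hG (s t)) hα
    fun i j hij => (hα₀ _ i j hij).trans
      (h.monotoneOn_weight (fun i j => (hβ i j).le) i j (left_mem_Icc.2 hT)
        (Ico_subset_Icc_self ht) ht.1)
  have hN : (0 : ℝ) < N ^ 3 :=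
    pow_pos (Nat.cast_pos.2 (Fin.pos_iff_nonempty.2 (hG (s t)).nonempty)) 3
  rw [neg_mul, neg_le_neg_iff]
  refine le_of_mul_le_mul_left (le_trans ?_ dissipation) hN
  rw [← mul_assoc]
  exact mul_le_mul_of_nonneg_right hr (sub_nonneg.2 (hQ.totalCost_le admissible.1))

theorem exists_decay_rate (hc : ∀ i, 0 < (gen i).c) (hδ : 0 < δ) (hβ : ∀ i j, 0 < β i j)
    (hβ_symm : ∀ i j, β i j = β j i) (hG : ∀ k, (G k).Connected)
    (hQ : IsOptimalDispatch gen δ D Q) (hα : 0 < α) :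
    ∃ r, 0 < r ∧ ∀ s T x, 0 ≤ T → IsTrajectory gen δ β G s T x →
      IsAdmissibleState gen D G (x 0) → (∀ k i j, (G k).Adj i j → α ≤ (x 0).2 i j) →
      totalCost gen δ (x T).1 - totalCost gen δ Q ≤
        (totalCost gen δ (x 0).1 - totalCost gen δ Q) * Real.exp (-r * T) := by
  obtain ⟨c₀, hc₀, hc₀_le⟩ := exists_pos_forall_le hc
  refine ⟨8 * c₀ * α / (N ^ 3 + 1), by positivity, fun s T x hT h h₀ hα₀ =>
    h.totalCost_sub_le_mul_exp hT hδ.le hc₀ hc₀_le hβ hβ_symm hG hQ h₀ hα.le hα₀ ?_⟩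
  rw [mul_div_assoc', div_le_iff₀ (by positivity), mul_comm]
  gcongr
  exact le_add_of_nonneg_right zero_le_one

theorem AdmissibleWeights.exists_pos_forall_adj_le {A : Fin N → Fin N → ℝ}
    (hA : AdmissibleWeights G A) : ∃ α, 0 < α ∧ ∀ k i j, (G k).Adj i j → α ≤ A i j := by
  obtain ⟨α, hα, h⟩ := exists_pos_forall_le
    (f := fun l : {l : Fin N × Fin N // ∃ k, (G k).Adj l.1 l.2} => A l.1.1 l.1.2)
    fun ⟨_, k, hk⟩ => hA.2 k _ _ hk
  exact ⟨α, hα, fun k i j hij => h ⟨(i, j), k, hij⟩⟩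

theorem mul_laplacianForm_consensusError_le {H : SimpleGraph (Fin N)} {c : ℝ}
    (hθ : ∀ i j, H.Adj i j → c ≤ θ i j) (P : Fin N → ℝ) :
    c * laplacianForm H (consensusError gen δ P) ≤ dirichletForm H θ (incCost gen δ P) := by
  rw [laplacianForm_eq_dirichletForm]
  exact (congrArg (c * ·) (dirichletForm_sub_const _)).trans_le (mul_dirichletForm_one_le hθ)

theorem laplacianForm_nonneg (H : SimpleGraph (Fin N)) (e : Fin N → ℝ) : 0 ≤ laplacianForm H e :=
  (laplacianForm_eq_dirichletForm H e).symm ▸ dirichletForm_nonneg fun _ _ _ => zero_le_one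

theorem IsOptimalDispatch.exists_forall_abs_sub_lt_of_energy_lt (hc : ∀ i, 0 < (gen i).c)
    (hδ : 0 ≤ δ) (hβ : ∀ i j, 0 < β i j) (hQ : IsOptimalDispatch gen δ D Q)
    {ε : ℝ} (hε : 0 < ε) : ∃ ρ, 0 < ρ ∧ ∀ P ∈ dispatchSet gen D, ∀ θ A : Fin N → Fin N → ℝ,
      energy gen δ β G 1 θ Q P A < ρ →
        (∀ i, |P i - Q i| < ε) ∧ ∀ k i j, (G k).Adj i j → |A i j - θ i j| < ε := by
  obtain ⟨c₀, hc₀, hc₀_le⟩ := exists_pos_forall_le hc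
  obtain ⟨b, hb, hb_le⟩ := exists_pos_forall_le (f := fun l : Fin N × Fin N => (4 * β l.1 l.2)⁻¹)
    fun l => inv_pos.2 (mul_pos four_pos (hβ l.1 l.2))
  refine ⟨min c₀ b * ε ^ 2, by positivity, fun P hP θ A h => ?_⟩
  have excess_nonneg := sub_nonneg.2 (hQ.totalCost_le hP)
  have adaptation_nonneg := adaptationEnergy_nonneg (G := G) hβ θ A
  rw [energy_eq, one_mul] at h
  refine ⟨fun i => abs_lt_of_sq_lt_sq (lt_of_mul_lt_mul_left ?_ (hc i).le) hε.le,
    fun k i j hij => abs_lt_of_sq_lt_sq ?_ hε.le⟩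
  · calc (gen i).c * (P i - Q i) ^ 2
        ≤ totalCost gen δ P - totalCost gen δ Q := hQ.mul_sq_sub_le (fun i => (hc i).le) hδ hP i
      _ < min c₀ b * ε ^ 2 := by linarith
      _ ≤ (gen i).c * ε ^ 2 := by
        gcongr
        exact (min_le_left _ _).trans (hc₀_le i)
  · have hβij : 0 < 4 * β i j := mul_pos four_pos (hβ i j)
    calc (A i j - θ i j) ^ 2
        = (θ i j - A i j) ^ 2 := sub_sq_comm _ _
      _ ≤ 4 * β i j * adaptationEnergy β G θ A := sq_sub_le_adaptationEnergy hβ θ A hij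
      _ < 4 * β i j * (min c₀ b * ε ^ 2) := by
        gcongr
        linarith
      _ ≤ 4 * β i j * ((4 * β i j)⁻¹ * ε ^ 2) := by
        gcongr
        exact (min_le_right _ _).trans (hb_le (i, j))
      _ = ε ^ 2 := mul_inv_cancel_left₀ hβij.ne' _

theorem IsOptimalDispatch.eventually_energy_lt
    (hQ : IsOptimalDispatch gen δ D Q) (θ : Fin N → Fin N → ℝ) {ρ : ℝ} (hρ : 0 < ρ) :
    ∀ᶠ x : ProtocolState N in 𝓝 (Q, θ), energy gen δ β G γ θ Q x.1 x.2 < ρ := by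
  have energy_zero : energy gen δ β G γ θ Q Q θ = 0 := by
    rw [energy_eq, adaptationEnergy_self, sub_self, add_zero, mul_zero]
  have nhds : stateDomain gen ∈ 𝓝 (Q, θ) := (isOpen_stateDomain gen).mem_nhds hQ.1.1
  exact ((continuousOn_energy gen δ β G γ θ Q).continuousAt nhds).eventually
    (gt_mem_nhds (energy_zero.trans_lt hρ))

namespace IsProtocolSolution

variable {P : ℝ → Fin N → ℝ} {A : ℝ → Fin N → Fin N → ℝ}

theorem isAdmissibleState (h : IsProtocolSolution gen δ β G s P A) (hc : ∀ i, 0 < (gen i).c)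
    (hδ : 0 < δ) (hβ : ∀ i j, 0 < β i j) (hβ_symm : ∀ i j, β i j = β j i)
    (hQ : IsOptimalDispatch gen δ D Q) (h₀ : IsAdmissibleState gen D G (P 0, A 0)) {t : ℝ}
    (ht : 0 ≤ t) : IsAdmissibleState gen D G (P t, A t) :=
  (h.isTrajectory hc hδ hβ hβ_symm hQ h₀ t).isAdmissibleState ht hβ hβ_symm h₀

theorem tendsto_power (h : IsProtocolSolution gen δ β G s P A) (hc : ∀ i, 0 < (gen i).c)
    (hδ : 0 < δ) (hβ : ∀ i j, 0 < β i j) (hβ_symm : ∀ i j, β i j = β j i)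
    (hG : ∀ k, (G k).Connected) (hQ : IsOptimalDispatch gen δ D Q)
    (h₀ : IsAdmissibleState gen D G (P 0, A 0)) : Tendsto P atTop (𝓝 Q) := by
  obtain ⟨α, hα, hα_le⟩ := h₀.2.exists_pos_forall_adj_le
  obtain ⟨r, hr, decay⟩ := exists_decay_rate hc hδ hβ hβ_symm hG hQ hα
  refine tendsto_pi_nhds.2 fun i => tendsto_sub_nhds_zero_iff.1 <|
    tendsto_zero_of_mul_sq_le_mul_exp (C := totalCost gen δ (P 0) - totalCost gen δ Q) (hc i) hr
      fun t ht => ?_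
  have excess_le := decay s t (fun t => (P t, A t)) ht
    (h.isTrajectory hc hδ hβ hβ_symm hQ h₀ t) h₀ hα_le
  exact (hQ.mul_sq_sub_le (fun i => (hc i).le) hδ.le
    (h.isAdmissibleState hc hδ hβ hβ_symm hQ h₀ ht).1 i).trans excess_le

theorem exists_tendsto_weight (h : IsProtocolSolution gen δ β G s P A)
    (hc : ∀ i, 0 < (gen i).c) (hδ : 0 < δ) (hβ : ∀ i j, 0 < β i j)
    (hβ_symm : ∀ i j, β i j = β j i) (hQ : IsOptimalDispatch gen δ D Q)
    (h₀ : IsAdmissibleState gen D G (P 0, A 0)) :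
    ∃ A₁, AdmissibleWeights G A₁ ∧ ∀ i j, Tendsto (fun t => A t i j) atTop (𝓝 (A₁ i j)) := by
  have trajectory := h.isTrajectory hc hδ hβ hβ_symm hQ h₀
  choose A₁ limit le_limit using fun i j => exists_tendsto_of_monotoneOn_Ici
    (f := fun t => A t i j) (a := 0)
    (C := A 0 i j + √(4 * β i j * (totalCost gen δ (P 0) - totalCost gen δ Q)))
    (fun a ha b hb hab => (trajectory b).monotoneOn_weight (fun i j => (hβ i j).le) i j
      ⟨ha, hab⟩ (right_mem_Icc.2 hb) hab)
    fun t ht => neg_le_sub_iff_le_add.1 (abs_le.1 (Real.abs_le_sqrt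
      ((trajectory t).sq_weight_sub_le ht hβ hβ_symm hQ h₀ i j))).1
  refine ⟨A₁, ⟨fun i j => tendsto_nhds_unique (limit i j) ((limit j i).congr' ?_),
    fun k i j hij => (h₀.2.2 k i j hij).trans_le (le_limit i j)⟩, limit⟩
  filter_upwards [eventually_ge_atTop 0] with t ht
  exact (trajectory t).weight_symm ht hβ_symm h₀.2.1 j i

theorem hasDerivWithinAt_energy (h : IsProtocolSolution gen δ β G s P A)
    (hc : ∀ i, 0 < (gen i).c) (hδ : 0 < δ) (hβ : ∀ i j, 0 < β i j)
    (hβ_symm : ∀ i j, β i j = β j i) (hQ : IsOptimalDispatch gen δ D Q)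
    (h₀ : IsAdmissibleState gen D G (P 0, A 0)) (γ : ℝ) (θ : Fin N → Fin N → ℝ) {t : ℝ}
    (ht : 0 ≤ t) : HasDerivWithinAt (fun t => energy gen δ β G γ θ Q (P t) (A t))
      (-γ * dirichletForm (G (s t)) θ (incCost gen δ (P t))) (Ici t) t :=
  (h.isTrajectory hc hδ hβ hβ_symm hQ h₀ (t + 1)).hasDerivWithinAt_energy hβ hβ_symm h₀.2.1 γ θ Q
    ⟨ht, lt_add_one t⟩

theorem exists_hasDerivWithinAt_energy_le (h : IsProtocolSolution gen δ β G s P A)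
    (hc : ∀ i, 0 < (gen i).c) (hδ : 0 < δ) (hβ : ∀ i j, 0 < β i j)
    (hβ_symm : ∀ i j, β i j = β j i) (hQ : IsOptimalDispatch gen δ D Q)
    (h₀ : IsAdmissibleState gen D G (P 0, A 0)) {θ₀ : ℝ} (hγ : 0 ≤ γ) (hθ₀ : 0 ≤ θ₀)
    (hθ : ∀ k i j, (G k).Adj i j → θ₀ ≤ θ i j) {t : ℝ} (ht : 0 ≤ t) :
    ∃ v : ℝ, HasDerivWithinAt (fun t => energy gen δ β G γ θ Q (P t) (A t)) v (Ici t) t ∧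
      v ≤ -γ * θ₀ * laplacianForm (G (s t)) (consensusError gen δ (P t)) ∧
      -γ * θ₀ * laplacianForm (G (s t)) (consensusError gen δ (P t)) ≤ 0 := by
  refine ⟨_, h.hasDerivWithinAt_energy hc hδ hβ hβ_symm hQ h₀ γ θ ht, ?_, ?_⟩
  · rw [mul_assoc]
    exact mul_le_mul_of_nonpos_left (mul_laplacianForm_consensusError_le (hθ (s t)) (P t))
      (neg_nonpos.2 hγ)
  · exact mul_nonpos_of_nonpos_of_nonneg (mul_nonpos_of_nonpos_of_nonneg (neg_nonpos.2 hγ) hθ₀)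
      (laplacianForm_nonneg _ _)

end IsProtocolSolution

theorem IsOptimalDispatch.tendsto_incCost_sub {P : ℝ → Fin N → ℝ}
    (hQ : IsOptimalDispatch gen δ D Q) (hP : Tendsto P atTop (𝓝 Q)) (i j : Fin N) :
    Tendsto (fun t => incCost gen δ (P t) i - incCost gen δ (P t) j) atTop (𝓝 0) := by
  have limit : Tendsto (fun t => incCost gen δ (P t)) atTop (𝓝 (incCost gen δ Q)) :=
    (((contDiffOn_incCost gen δ).continuousOn.continuousAt
      ((isOpen_capacityBox gen).mem_nhds hQ.1.1)).tendsto).comp hP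
  simpa only [hQ.incCost_eq i j, sub_self] using
    (tendsto_pi_nhds.1 limit i).sub (tendsto_pi_nhds.1 limit j)

theorem IsOptimalDispatch.exists_stability_radius (hc : ∀ i, 0 < (gen i).c) (hδ : 0 < δ)
    (hβ : ∀ i j, 0 < β i j) (hβ_symm : ∀ i j, β i j = β j i) (hQ : IsOptimalDispatch gen δ D Q)
    {A₁ : Fin N → Fin N → ℝ} (hA₁ : AdmissibleWeights G A₁) {ε : ℝ} (hε : 0 < ε) :
    ∃ η : ℝ, 0 < η ∧ ∀ s P A, IsProtocolSolution gen δ β G s P A →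
      IsAdmissibleState gen D G (P 0, A 0) → (∀ i, |P 0 i - Q i| < η) →
      (∀ i j, |A 0 i j - A₁ i j| < η) →
      ∀ t, 0 ≤ t → (∀ i, |P t i - Q i| < ε) ∧ ∀ i j, |A t i j - A₁ i j| < ε := by
  obtain ⟨ρ, hρ, near⟩ := hQ.exists_forall_abs_sub_lt_of_energy_lt (G := G) hc hδ.le hβ hε
  obtain ⟨η, hη, small⟩ := Metric.eventually_nhds_iff.1 (hQ.eventually_energy_lt A₁ hρ)
  refine ⟨min η ε, lt_min hη hε, fun s P A h h₀ hP₀ hA₀ t ht => ?_⟩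
  have dist_lt : dist (P 0, A 0) (Q, A₁) < η := max_lt
    ((dist_pi_lt_iff hη).2 fun i => (hP₀ i).trans_le (min_le_left _ _))
    ((dist_pi_lt_iff hη).2 fun i => (dist_pi_lt_iff hη).2 fun j =>
      (hA₀ i j).trans_le (min_le_left _ _))
  have trajectory := h.isTrajectory hc hδ hβ hβ_symm hQ h₀ t
  have energy_le := trajectory.energy_le ht hβ hβ_symm h₀.2.1 (γ := 1) zero_le_one
    (fun k i j hij => (hA₁.2 k i j hij).le) Q
  obtain ⟨power_near, weight_near⟩ := near (P t) (trajectory.isAdmissibleState ht hβ hβ_symm h₀).1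
    A₁ (A t) (energy_le.trans_lt (small dist_lt))
  refine ⟨power_near, fun i j => ?_⟩
  by_cases hij : ∃ k, (G k).Adj i j
  · exact hij.elim fun k hk => weight_near k i j hk
  · have held : A t i j = A 0 i j :=
      trajectory.weight_eq_of_forall_not_adj ht (not_exists.1 hij)
    exact held.symm ▸ (hA₀ i j).trans_le (min_le_right _ _)

theorem IsOptimalDispatch.exists_norm_consensusError_le (hc : ∀ i, 0 < (gen i).c) (hδ : 0 < δ)
    (hβ : ∀ i j, 0 < β i j) (hβ_symm : ∀ i j, β i j = β j i) (hG : ∀ k, (G k).Connected)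
    (hQ : IsOptimalDispatch gen δ D Q) {μ : ℝ} (hμ : 0 < μ) (hα : 0 < α) :
    ∃ K, 0 < K ∧ ∃ r, 0 < r ∧ ∀ s P A, IsProtocolSolution gen δ β G s P A →
      IsAdmissibleState gen D G (P 0, A 0) → P 0 ∈ marginBox gen μ →
      (∀ k i j, (G k).Adj i j → α ≤ A 0 i j) →
      ∀ t, 0 ≤ t → ‖WithLp.toLp 2 (consensusError gen δ (P t))‖ ≤
        K * Real.exp (-r * t) * ‖WithLp.toLp 2 (consensusError gen δ (P 0))‖ := by
  obtain ⟨E, hE⟩ := (isCompact_marginBox gen μ).bddAbove_image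
    ((continuousOn_totalCost gen δ).mono (marginBox_subset_capacityBox hμ))
  obtain ⟨c₀, hc₀, hc₀_le⟩ := exists_pos_forall_le hc
  obtain ⟨B, hB, error_le⟩ :=
    hQ.exists_sum_consensusError_sq_le_of_totalCost_le hδ hc₀ hc₀_le E
  obtain ⟨r, hr, decay⟩ := exists_decay_rate hc hδ hβ hβ_symm hG hQ hα
  refine ⟨√(B / (4 * c₀)), by positivity, r / 2, by positivity,
    fun s P A h h₀ hP₀ hA₀ t ht => le_of_sq_le_sq ?_ (by positivity)⟩
  have trajectory := h.isTrajectory hc hδ hβ hβ_symm hQ h₀ t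
  have cost_le : totalCost gen δ (P t) ≤ E :=
    (trajectory.totalCost_le ht hβ hβ_symm h₀).trans (hE (mem_image_of_mem _ hP₀))
  have excess_le : totalCost gen δ (P 0) - totalCost gen δ Q ≤
      (∑ i, consensusError gen δ (P 0) i ^ 2) / (4 * c₀) :=
    (le_div_iff₀' (by positivity)).2 (hQ.totalCost_sub_le hδ.le hc₀ hc₀_le h₀.1)
  have exp_sq : Real.exp (-(r / 2) * t) ^ 2 = Real.exp (-r * t) := by
    rw [← Real.exp_nat_mul]
    congr 1
    push_cast
    ring
  rw [mul_pow, mul_pow, Real.sq_sqrt (by positivity), exp_sq, EuclideanSpace.real_norm_sq_eq,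
    EuclideanSpace.real_norm_sq_eq]
  calc ∑ i, consensusError gen δ (P t) i ^ 2
      ≤ B * (totalCost gen δ (P t) - totalCost gen δ Q) :=
        error_le _ (trajectory.isAdmissibleState ht hβ hβ_symm h₀).1 cost_le
    _ ≤ B * ((totalCost gen δ (P 0) - totalCost gen δ Q) * Real.exp (-r * t)) := by
        gcongr
        exact decay s t (fun t => (P t, A t)) ht trajectory h₀ hA₀
    _ ≤ B * ((∑ i, consensusError gen δ (P 0) i ^ 2) / (4 * c₀) * Real.exp (-r * t)) := by
        gcongr
    _ = B / (4 * c₀) * Real.exp (-r * t) * ∑ i, consensusError gen δ (P 0) i ^ 2 := by ring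

end Protocol

theorem theorem4_general {N M : ℕ} (gen : Fin N → Generator) (δ D : ℝ) (β : Fin N → Fin N → ℝ)
    (G : Fin M → SimpleGraph (Fin N))
    (hc : ∀ i, 0 < (gen i).c) (hδ : 0 < δ)
    (hβ : ∀ i j, 0 < β i j) (hβ_symm : ∀ i j, β i j = β j i)
    (hG : ∀ k, (G k).Connected)
    (hD : (dispatchSet gen D).Nonempty) :
    ∃ Q : Fin N → ℝ, IsOptimalDispatch gen δ D Q ∧
      (∀ Q', IsOptimalDispatch gen δ D Q' → Q' = Q) ∧
      (∀ s : ℝ → Fin M, IsSwitchingSignal s →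
        ∀ P₀ ∈ dispatchSet gen D, ∀ A₀, AdmissibleWeights G A₀ →
        ∃ P A, (IsProtocolSolution gen δ β G s P A ∧ P 0 = P₀ ∧ A 0 = A₀) ∧
          ∀ P' A', IsProtocolSolution gen δ β G s P' A' → P' 0 = P₀ → A' 0 = A₀ →
            ∀ t, 0 ≤ t → P' t = P t ∧ A' t = A t) ∧
      (∀ (s : ℝ → Fin M) P A, IsProtocolSolution gen δ β G s P A →
        P 0 ∈ dispatchSet gen D → AdmissibleWeights G (A 0) →
        (∀ t, 0 ≤ t → P t ∈ dispatchSet gen D) ∧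
        (∀ i j, Tendsto (fun t => incCost gen δ (P t) i - incCost gen δ (P t) j)
          atTop (𝓝 0)) ∧
        (∀ i, Tendsto (fun t => P t i) atTop (𝓝 (Q i))) ∧
        ∃ A₁, AdmissibleWeights G A₁ ∧
          ∀ i j, Tendsto (fun t => A t i j) atTop (𝓝 (A₁ i j))) ∧
      (∀ A₁, AdmissibleWeights G A₁ → ∀ ε : ℝ, 0 < ε → ∃ η : ℝ, 0 < η ∧
        ∀ (s : ℝ → Fin M) P A, IsProtocolSolution gen δ β G s P A →
        P 0 ∈ dispatchSet gen D → AdmissibleWeights G (A 0) →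
        (∀ i, |P 0 i - Q i| < η) → (∀ i j, |A 0 i j - A₁ i j| < η) →
        ∀ t, 0 ≤ t → (∀ i, |P t i - Q i| < ε) ∧ ∀ i j, |A t i j - A₁ i j| < ε) ∧
      (∀ μ : ℝ, 0 < μ → ∀ α : ℝ, 0 < α → ∃ K : ℝ, 0 < K ∧ ∃ r : ℝ, 0 < r ∧
        ∀ (s : ℝ → Fin M) P A, IsProtocolSolution gen δ β G s P A →
        P 0 ∈ dispatchSet gen D → AdmissibleWeights G (A 0) →
        (∀ i, (gen i).pmin + μ ≤ P 0 i ∧ P 0 i ≤ (gen i).pmax - μ) →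
        (∀ k i j, (G k).Adj i j → α ≤ A 0 i j) →
        ∀ t, 0 ≤ t → ‖WithLp.toLp 2 (consensusError gen δ (P t))‖ ≤
          K * Real.exp (-r * t) * ‖WithLp.toLp 2 (consensusError gen δ (P 0))‖) ∧
      (∀ (γ θ₀ : ℝ) (θ : Fin N → Fin N → ℝ), 0 < γ → 0 < θ₀ →
        (∀ k i j, (G k).Adj i j → θ₀ ≤ θ i j) →
        (∀ P ∈ dispatchSet gen D, ∀ A, 0 ≤ energy gen δ β G γ θ Q P A ∧
          (energy gen δ β G γ θ Q P A = 0 ↔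
            P = Q ∧ ∀ k i j, (G k).Adj i j → A i j = θ i j)) ∧
        ∀ (s : ℝ → Fin M) P A, IsProtocolSolution gen δ β G s P A →
        P 0 ∈ dispatchSet gen D → AdmissibleWeights G (A 0) → ∀ t, 0 ≤ t →
        ∃ v : ℝ, HasDerivWithinAt (fun τ => energy gen δ β G γ θ Q (P τ) (A τ)) v (Ici t) t ∧
          v ≤ -γ * θ₀ * laplacianForm (G (s t)) (consensusError gen δ (P t)) ∧
          -γ * θ₀ * laplacianForm (G (s t)) (consensusError gen δ (P t)) ≤ 0) := by
  obtain ⟨Q, hQ⟩ := exists_isOptimalDispatch hc hδ hD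
  refine ⟨Q, hQ, fun _ => hQ.unique hc hδ.le, ?_, ?_, ?_, ?_, ?_⟩
  · rintro s hs P₀ hP₀ A₀ hA₀
    obtain ⟨P, A, h, rfl, rfl⟩ := exists_isProtocolSolution hc hδ hβ hβ_symm hQ hs
      (x₀ := (P₀, A₀)) ⟨hP₀, hA₀⟩
    exact ⟨P, A, ⟨h, rfl, rfl⟩, fun P' A' h' hP hA t =>
      h.unique h' hc hδ hβ hβ_symm hQ ⟨hP₀, hA₀⟩ hP hA⟩
  · intro s P A h hP hA
    have limit := h.tendsto_power hc hδ hβ hβ_symm hG hQ ⟨hP, hA⟩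
    exact ⟨fun t ht => (h.isAdmissibleState hc hδ hβ hβ_symm hQ ⟨hP, hA⟩ ht).1,
      hQ.tendsto_incCost_sub limit, tendsto_pi_nhds.1 limit,
      h.exists_tendsto_weight hc hδ hβ hβ_symm hQ ⟨hP, hA⟩⟩
  · intro A₁ hA₁ ε hε
    obtain ⟨η, hη, near⟩ := hQ.exists_stability_radius hc hδ hβ hβ_symm hA₁ hε
    exact ⟨η, hη, fun s P A h hP hA => near s P A h ⟨hP, hA⟩⟩
  · intro μ hμ α hα
    obtain ⟨K, hK, r, hr, le⟩ := hQ.exists_norm_consensusError_le hc hδ hβ hβ_symm hG hμ hα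
    exact ⟨K, hK, r, hr, fun s P A h hP hA hμP =>
      le s P A h ⟨hP, hA⟩ ⟨fun i => (hμP i).1, fun i => (hμP i).2⟩⟩
  · intro γ θ₀ θ hγ hθ₀ hθ
    exact ⟨fun P hP A => ⟨hQ.energy_nonneg hβ hγ.le hP θ A,
      hQ.energy_eq_zero_iff hc hδ.le hβ hγ hP⟩, fun s P A h hP hA t =>
      h.exists_hasDerivWithinAt_energy_le hc hδ hβ hβ_symm hQ ⟨hP, hA⟩ hγ.le hθ₀.le hθ⟩

theorem theorem4 {N M : ℕ} (gen : Fin N → Generator) (δ D : ℝ) (β : Fin N → Fin N → ℝ)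
    (G : Fin M → SimpleGraph (Fin N))
    (hc : ∀ i, 0 < (gen i).c) (hδ : 0 < δ)
    (hβ : ∀ i j, 0 < β i j) (hβ_symm : ∀ i j, β i j = β j i)
    (hG : ∀ k, (G k).Connected)
    (hD : (dispatchSet gen D).Nonempty) :
    -- the dispatch problem has a unique solution
    ∃ Q : Fin N → ℝ, IsOptimalDispatch gen δ D Q ∧
      (∀ Q', IsOptimalDispatch gen δ D Q' → Q' = Q) ∧
      -- the switched protocol has a unique global solution for all initial data
      (∀ s : ℝ → Fin M, IsSwitchingSignal s →
        ∀ P₀ ∈ dispatchSet gen D, ∀ A₀, AdmissibleWeights G A₀ →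
        ∃ P A, (IsProtocolSolution gen δ β G s P A ∧ P 0 = P₀ ∧ A 0 = A₀) ∧
          ∀ P' A', IsProtocolSolution gen δ β G s P' A' → P' 0 = P₀ → A' 0 = A₀ →
            ∀ t, 0 ≤ t → P' t = P t ∧ A' t = A t) ∧
      -- balance and limits at all times, consensus, convergence to the optimum
      (∀ s : ℝ → Fin M, IsSwitchingSignal s → ∀ P A, IsProtocolSolution gen δ β G s P A →
        P 0 ∈ dispatchSet gen D → AdmissibleWeights G (A 0) →
        (∀ t, 0 ≤ t → P t ∈ dispatchSet gen D) ∧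
        (∀ i j, Tendsto (fun t => incCost gen δ (P t) i - incCost gen δ (P t) j)
          atTop (𝓝 0)) ∧
        (∀ i, Tendsto (fun t => P t i) atTop (𝓝 (Q i))) ∧
        ∃ A₁, AdmissibleWeights G A₁ ∧
          ∀ i j, Tendsto (fun t => A t i j) atTop (𝓝 (A₁ i j))) ∧
      -- Lyapunov stability, uniform in the switching signal
      (∀ A₁, AdmissibleWeights G A₁ → ∀ ε : ℝ, 0 < ε → ∃ η : ℝ, 0 < η ∧
        ∀ s : ℝ → Fin M, IsSwitchingSignal s → ∀ P A, IsProtocolSolution gen δ β G s P A →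
        P 0 ∈ dispatchSet gen D → AdmissibleWeights G (A 0) →
        (∀ i, |P 0 i - Q i| < η) → (∀ i j, |A 0 i j - A₁ i j| < η) →
        ∀ t, 0 ≤ t → (∀ i, |P t i - Q i| < ε) ∧ ∀ i j, |A t i j - A₁ i j| < ε) ∧
      -- exponential stability of the consensus error, uniform in the switching signal
      (∀ μ : ℝ, 0 < μ → ∀ α : ℝ, 0 < α → ∃ K : ℝ, 0 < K ∧ ∃ r : ℝ, 0 < r ∧
        ∀ s : ℝ → Fin M, IsSwitchingSignal s → ∀ P A, IsProtocolSolution gen δ β G s P A →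
        P 0 ∈ dispatchSet gen D → AdmissibleWeights G (A 0) →
        (∀ i, (gen i).pmin + μ ≤ P 0 i ∧ P 0 i ≤ (gen i).pmax - μ) →
        (∀ k i j, (G k).Adj i j → α ≤ A 0 i j) →
        ∀ t, 0 ≤ t → ‖WithLp.toLp 2 (consensusError gen δ (P t))‖ ≤
          K * Real.exp (-r * t) * ‖WithLp.toLp 2 (consensusError gen δ (P 0))‖) ∧
      -- a common Lyapunov function for all modes
      (∀ (γ θ₀ : ℝ) (θ : Fin N → Fin N → ℝ), 0 < γ → 0 < θ₀ → (∀ i j, θ i j = θ j i) →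
        (∀ k i j, (G k).Adj i j → θ₀ ≤ θ i j) →
        (∀ P ∈ dispatchSet gen D, ∀ A, 0 ≤ energy gen δ β G γ θ Q P A ∧
          (energy gen δ β G γ θ Q P A = 0 ↔
            P = Q ∧ ∀ k i j, (G k).Adj i j → A i j = θ i j)) ∧
        ∀ s : ℝ → Fin M, IsSwitchingSignal s → ∀ P A, IsProtocolSolution gen δ β G s P A →
        P 0 ∈ dispatchSet gen D → AdmissibleWeights G (A 0) → ∀ t, 0 ≤ t →
        ∃ v : ℝ, HasDerivWithinAt (fun τ => energy gen δ β G γ θ Q (P τ) (A τ)) v (Ici t) t ∧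
          v ≤ -γ * θ₀ * laplacianForm (G (s t)) (consensusError gen δ (P t)) ∧
          -γ * θ₀ * laplacianForm (G (s t)) (consensusError gen δ (P t)) ≤ 0) := by
  obtain ⟨Q, hQ, unique, solution, limit, stable, decay, lyapunov⟩ :=
    theorem4_general gen δ D β G hc hδ hβ hβ_symm hG hD
  exact ⟨Q, hQ, unique, solution, fun s _ => limit s,
    fun A₁ hA₁ ε hε => (stable A₁ hA₁ ε hε).imp fun _ h => ⟨h.1, fun s _ => h.2 s⟩,
    fun μ hμ α hα => (decay μ hμ α hα).imp fun _ hK => ⟨hK.1, hK.2.imp fun _ hr =>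
      ⟨hr.1, fun s _ => hr.2 s⟩⟩,
    fun γ θ₀ θ hγ hθ₀ _ hθ => (lyapunov γ θ₀ θ hγ hθ₀ hθ).imp_right fun h s _ => h s⟩
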